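/- **Setting.** Let $\Sigma$ be a finite alphabet. A pomset is an isomorphism class of finite strictly partially ordered sets labelled by $\Sigma$. $P\cdot Q$ (sequential composition) is the disjoint union with every element of $P$ below every element of $Q$; $P\parallel Q$ is the disjoint union with no comparabilities added. $\mathrm{SP}$ is the least set of pomsets containing the empty pomset $\varepsilon$ and the one-element pomsets $a\in\Sigma$ and closed under $\cdot$ and $\parallel$; $\circ$ denotes either operation. A *context* is a series-parallel pomset over $\Sigma\cup\{\square\}$ with exactly one $\square$-labelled element; $c[w]$ is obtained by substituting $w$ for $\square$. A *pomset recognizer* (PR) is a finite set $M$ with two associative operations (one for $\cdot$, and a commutative one for $\parallel$) with a common neutral element, a map $i:\Sigma\to M$ and a set $F\subseteq M$; $i$ extends to a unique homomorphism $\mathrm{eval}:\mathrm{SP}\to M$, and the language of the PR is $\{w : \mathrm{eval}(w)\in F\}$. A language $L\subseteq\mathrm{SP}$ is *recognizable* if it is the language of a PR. A term is a binary tree with inner nodes labelled by $\cdot,\parallel$ and leaves labelled by $\Sigma\cup\{\varepsilon\}$. A *canonical decomposition* $z=z_1\circ z_2$ is given by the root and the two subtrees of a term of minimal depth describing $z$,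 without $\varepsilon$-leaves if $z\ne\varepsilon$. Let $L$ be recognizable. A *minimally adequate teacher* answers membership queries "$w\in L$?" and equivalence queries "is $L$ the language of $H$?", the latter with an arbitrary counter-example (a $w\in\mathrm{SP}$ on which $L$ and the language of $H$ disagree) if the answer is no. Write $M(w)$ and $H(w)$ for the truth values of "$w\in L$" and of "$w$ is in the language of $H$". **Data.** A finite set $S\subset\mathrm{SP}$; a finite collection $\mathcal B$ of finite sets of pomsets (components); a binary tree $\mathcal D$ with inner nodes labelled by contexts, and with leaves that are unlabelled or labelled by components, where $\mathcal B$ is the set of leaf labels; a hypothesis $H$. Sifting $w$ means descending from the root, going right at a node labelled $c$ if $c[w]\in L$ and left otherwise; $\mathcal D(w)$ is the label of the leaf reached (undefined if the leaf is unlabelled). $\mathcal B_s$ is the component containing $s$; $\mathrm{as}(s)=S\cap\mathcal B_s$; $\mathcal C$ is the set of contexts in $\mathcal D$ and $\mathcal C_B$ the set of those on the branch leading to $B$. $\mathrm{as}_H(w)=S\cap\mathrm{eval}_H(w)$ (states of $H$ are components), and $\mathrm{agree}(c,z)$ means that $H(c[p])=M(c[p])$ for all $p\in\mathrm{as}_H(z)$.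 * $\mathtt{Expand}(w)$: put $w$ into $S$; then for each $p$ in $\{w\}$, then each $p$ in $\{p'\circ w,\,w\circ p' : p'\in S\}$, then each $p$ in $\Sigma$, if $p$ is in no component: if $\mathcal D(p)$ is defined, add $p$ to it; otherwise label the leaf by a new component $\{p\}$ and call $\mathtt{Expand}(p)$. * $\mathtt{Refine}(B,c)$, where $M(c[\cdot])$ is not constant on $B\in\mathcal B$: replace the leaf $B$ by a node labelled $c$ with left leaf $B_0=\{w\in B: c[w]\notin L\}$ and right leaf $B_1=\{w\in B: c[w]\in L\}$; then for $j=0,1$, if $S\cap B_j=\emptyset$, call $\mathtt{Expand}(p_j)$ for some $p_j\in B_j$. * $\mathtt{MakeConsistent}$: while there are $\circ$, $B\in\mathcal B$, $p_1,p_2\in S\cap B$, $p\in S$ with $\mathcal D(p_1\circ p)\ne\mathcal D(p_2\circ p)$ (or $\mathcal D(p\circ p_1)\ne\mathcal D(p\circ p_2)$), choose $c\in\mathcal C$ with $M(c[p_1\circ p])\neq M(c[p_2\circ p])$ and call $\mathtt{Refine}(B,c[\square\circ p])$ (respectively choose $c\in\mathcal C$ with $M(c[p\circ p_1])\neq M(c[p\circ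 p_2])$ and call $\mathtt{Refine}(B,c[p\circ\square])$). Return whether no call was made. * $\mathtt{MakeAssoc}$: while there are $\circ$, $s_1,s_2,s_3\in S$, $s_l\in\mathrm{as}(s_1\circ s_2)$, $s_r\in\mathrm{as}(s_2\circ s_3)$ with $\mathcal D(s_1\circ s_r)\ne\mathcal D(s_l\circ s_3)$, choose $c\in\mathcal C$ with $M(c[s_1\circ s_r])\ne M(c[s_l\circ s_3])$; if $M(c[s_l\circ s_3])\neq M(c[s_1\circ s_2\circ s_3])$ call $\mathtt{Refine}(\mathcal B_{s_1\circ s_2},c[\square\circ s_3])$, otherwise call $\mathtt{Refine}(\mathcal B_{s_2\circ s_3},c[s_1\circ\square])$. Return whether no call was made. * $\mathtt{BuildHypothesis}$: $H$ is the PR with set of states $\mathcal B$, operations $\mathcal B_u\circ\mathcal B_v=\mathcal B_{u\circ v}$ ($u,v\in S$), neutral element $\mathcal B_\varepsilon$, $i(a)=\mathcal B_a$, accepting states the $B\in\mathcal B$ with $B\subseteq L$. * $\mathtt{FindEBP}(c,z)$: if $z\in\Sigma$, return $(c,z)$. Otherwise take a canonical decomposition $z=z_1\circ z_2$. If $\mathrm{agree}(c[\square\circ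 z_2],z_1)$, return $\mathtt{FindEBP}(c[\square\circ z_2],z_1)$. Otherwise take $p_1\in\mathrm{as}_H(z_1)$ with $H(c[p_1\circ z_2])\ne M(c[p_1\circ z_2])$; if $\mathrm{agree}(c[p_1\circ\square],z_2)$, return $\mathtt{FindEBP}(c[p_1\circ\square],z_2)$; otherwise take $p_2\in\mathrm{as}_H(z_2)$ with $H(c[p_1\circ p_2])\ne M(c[p_1\circ p_2])$ and return $(c,p_1\circ p_2)$. * $\mathtt{HandleCE}(w)$: start a pool with $\{w\}$. While some $u$ in the pool has $M(u)\ne H(u)$: let $(c,p)$ be the result of $\mathtt{FindEBP}(\square,u)$, add $c[p]$ and all $c[p']$, $p'\in\mathrm{as}_H(p)$, to the pool, call $\mathtt{Expand}(p)$, repeat $\mathtt{MakeConsistent}$ and $\mathtt{MakeAssoc}$ until both report no call, and rebuild $H$. * $\mathtt{Learn}$: start with $S=\mathcal B=\emptyset$ and $\mathcal D$ a root labelled $\square$ with two unlabelled leaves; call $\mathtt{Expand}(\varepsilon)$ and build $H$. While the equivalence query for $H$ returns a counter-example $w$: call $\mathtt{HandleCE}(w)$, and then, while there are $B\in\mathcal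 B$, $s\in B$, $c\in\mathcal C_B$ with $H(c[s])\neq M(c[s])$, call $\mathtt{HandleCE}(c[s])$. Finally return $H$. **Theorem.** For every finite alphabet $\Sigma$, every recognizable $L\subseteq\mathrm{SP}$, every behaviour of the teacher, and every way of making the choices that the algorithm leaves open, $\mathtt{Learn}$ terminates (there is no infinite run, and no run gets stuck before returning), and it returns a pomset recognizer $H$ whose language is $L$. -/

import Mathlib

namespace PomsetLearning

universe u v

/-! ## Posets and pomsets -/

/-- A finite, strictly partially ordered set labelled by `A`. -/
structure LPoset (A : Type u) : Type (max u 1) where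
  carrier : Type
  finite : Finite carrier
  lt : carrier → carrier → Prop
  irrefl : ∀ x, ¬ lt x x
  trans : ∀ x y z, lt x y → lt y z → lt x z
  label : carrier → A

namespace LPoset

variable {A : Type u} {A' : Type v}

/-- Two labelled posets are isomorphic if some bijection preserves and reflects the order and
preserves the labels. -/
def Isom (P Q : LPoset A) : Prop :=
  ∃ e : P.carrier ≃ Q.carrier,
    (∀ x y, Q.lt (e x) (e y) ↔ P.lt x y) ∧ ∀ x, Q.label (e x) = P.label x

theorem Isom.refl (P : LPoset A) : Isom P P :=
  ⟨Equiv.refl _, fun _ _ => Iff.rfl, fun _ => rfl⟩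

theorem Isom.symm {P Q : LPoset A} (h : Isom P Q) : Isom Q P := by
  obtain ⟨e, h1, h2⟩ := h
  refine ⟨e.symm, fun x y => ?_, fun x => ?_⟩
  · rw [← h1, e.apply_symm_apply, e.apply_symm_apply]
  · rw [← h2, e.apply_symm_apply]

theorem Isom.trans {P Q R : LPoset A} (h : Isom P Q) (k : Isom Q R) : Isom P R := by
  obtain ⟨e, h1, h2⟩ := h
  obtain ⟨f, k1, k2⟩ := k
  refine ⟨e.trans f, fun x y => ?_, fun x => ?_⟩
  · rw [Equiv.trans_apply, Equiv.trans_apply, k1, h1]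
  · rw [Equiv.trans_apply, k2, h2]

instance setoid (A : Type u) : Setoid (LPoset A) :=
  ⟨Isom, Isom.refl, Isom.symm, Isom.trans⟩

/-- The empty poset. -/
def empty : LPoset A where
  carrier := Empty
  finite := inferInstance
  lt _ _ := False
  irrefl _ h := h
  trans _ _ _ h _ := h
  label x := x.elim

/-- The one-element poset labelled by `a`. -/
def single (a : A) : LPoset A where
  carrier := Unit
  finite := inferInstance
  lt _ _ := False
  irrefl _ h := h
  trans _ _ _ h _ := h
  label _ := a

/-- Disjoint union, every element of `P` being below every element of `Q`. -/
def seq (P Q : LPoset A) : LPoset A where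
  carrier := P.carrier ⊕ Q.carrier
  finite := by
    have := P.finite
    have := Q.finite
    infer_instance
  lt := Sum.Lex P.lt Q.lt
  irrefl := by
    rintro (x | x) h
    · exact P.irrefl x (Sum.lex_inl_inl.1 h)
    · exact Q.irrefl x (Sum.lex_inr_inr.1 h)
  trans := by
    rintro (x | x) (y | y) (z | z) h k <;>
      simp only [Sum.lex_inl_inl, Sum.lex_inr_inr, Sum.lex_inr_inl, Sum.Lex.sep] at h k ⊢
    · exact P.trans _ _ _ h k
    · exact Q.trans _ _ _ h k
  label := Sum.elim P.label Q.label

/-- Disjoint union, the elements of `P` and of `Q` being incomparable. -/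
def par (P Q : LPoset A) : LPoset A where
  carrier := P.carrier ⊕ Q.carrier
  finite := by
    have := P.finite
    have := Q.finite
    infer_instance
  lt := Sum.LiftRel P.lt Q.lt
  irrefl := by
    rintro (x | x) h
    · exact P.irrefl x (Sum.liftRel_inl_inl.1 h)
    · exact Q.irrefl x (Sum.liftRel_inr_inr.1 h)
  trans := by
    rintro (x | x) (y | y) (z | z) h k <;>
      simp only [Sum.liftRel_inl_inl, Sum.liftRel_inr_inr, Sum.not_liftRel_inl_inr,
        Sum.not_liftRel_inr_inl] at h k ⊢
    · exact P.trans _ _ _ h k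
    · exact Q.trans _ _ _ h k
  label := Sum.elim P.label Q.label

/-- Substitution: every element `x` of `P` is replaced by a copy of `f (P.label x)`. -/
def bind (P : LPoset A) (f : A → LPoset A') : LPoset A' where
  carrier := Σ x : P.carrier, (f (P.label x)).carrier
  finite := by
    have := P.finite
    have := fun a => (f a).finite
    infer_instance
  lt := Sigma.Lex P.lt fun x => (f (P.label x)).lt
  irrefl := by
    rintro ⟨x, y⟩ h
    rcases Sigma.lex_iff.1 h with h | ⟨_, h⟩
    · exact P.irrefl x h
    · exact (f (P.label x)).irrefl y h
  trans := by
    rintro _ _ _ (h | h) (k | k)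
    · exact Sigma.Lex.left _ _ (P.trans _ _ _ (by assumption) (by assumption))
    · exact Sigma.Lex.left _ _ (by assumption)
    · exact Sigma.Lex.left _ _ (by assumption)
    · exact Sigma.Lex.right _ _ ((f _).trans _ _ _ (by assumption) (by assumption))
  label x := (f (P.label x.1)).label x.2

theorem seq_isom {P P' Q Q' : LPoset A} (h : Isom P P') (k : Isom Q Q') :
    Isom (seq P Q) (seq P' Q') := by
  obtain ⟨e, h1, h2⟩ := h
  obtain ⟨f, k1, k2⟩ := k
  refine ⟨Equiv.sumCongr e f, ?_, ?_⟩
  · rintro (x | x) (y | y)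
    · exact Sum.lex_inl_inl.trans ((h1 x y).trans Sum.lex_inl_inl.symm)
    · exact iff_of_true (Sum.Lex.sep _ _) (Sum.Lex.sep _ _)
    · exact iff_of_false Sum.lex_inr_inl Sum.lex_inr_inl
    · exact Sum.lex_inr_inr.trans ((k1 x y).trans Sum.lex_inr_inr.symm)
  · rintro (x | x)
    · exact h2 x
    · exact k2 x

theorem par_isom {P P' Q Q' : LPoset A} (h : Isom P P') (k : Isom Q Q') :
    Isom (par P Q) (par P' Q') := by
  obtain ⟨e, h1, h2⟩ := h
  obtain ⟨f, k1, k2⟩ := k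
  refine ⟨Equiv.sumCongr e f, ?_, ?_⟩
  · rintro (x | x) (y | y)
    · exact Sum.liftRel_inl_inl.trans ((h1 x y).trans Sum.liftRel_inl_inl.symm)
    · exact iff_of_false Sum.not_liftRel_inl_inr Sum.not_liftRel_inl_inr
    · exact iff_of_false Sum.not_liftRel_inr_inl Sum.not_liftRel_inr_inl
    · exact Sum.liftRel_inr_inr.trans ((k1 x y).trans Sum.liftRel_inr_inr.symm)
  · rintro (x | x)
    · exact h2 x
    · exact k2 x

theorem bind_isom {P Q : LPoset A} (h : Isom P Q) (f : A → LPoset A') :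
    Isom (bind P f) (bind Q f) := by
  obtain ⟨C, hC, r, hi, ht, l⟩ := P
  obtain ⟨e, h1, h2⟩ := h
  change C ≃ Q.carrier at e
  change ∀ x y : C, Q.lt (e x) (e y) ↔ r x y at h1
  change ∀ x : C, Q.label (e x) = l x at h2
  have hl : (fun x : C => Q.label (e x)) = l := funext h2
  clear h2
  subst hl
  refine ⟨Equiv.sigmaCongrLeft (β := fun y => (f (Q.label y)).carrier) e, ?_, fun _ => rfl⟩
  rintro ⟨x, x'⟩ ⟨y, y'⟩
  refine Sigma.lex_iff.trans (Iff.trans ?_ Sigma.lex_iff.symm)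
  constructor
  · rintro (h | ⟨h, k⟩)
    · exact Or.inl ((h1 _ _).1 h)
    · obtain rfl : x = y := e.injective h
      exact Or.inr ⟨rfl, k⟩
  · rintro (h | ⟨h, k⟩)
    · exact Or.inl ((h1 _ _).2 h)
    · obtain rfl : x = y := h
      exact Or.inr ⟨rfl, k⟩

theorem bind_empty (f : A → LPoset A') : Isom (bind empty f) empty :=
  ⟨⟨fun x => x.1, fun x => x.elim, fun x => x.1.elim, fun x => x.elim⟩,
    fun x => x.1.elim, fun x => x.1.elim⟩

theorem bind_single (a : A) (f : A → LPoset A') : Isom (bind (single a) f) (f a) := by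
  refine ⟨⟨fun x => x.2, fun x => ⟨(), x⟩, fun _ => rfl, fun _ => rfl⟩, ?_, fun _ => rfl⟩
  rintro ⟨⟨⟩, x⟩ ⟨⟨⟩, y⟩
  refine Iff.trans ?_ Sigma.lex_iff.symm
  exact ⟨fun h => Or.inr ⟨rfl, h⟩, fun h => h.elim False.elim fun h => h.2⟩

theorem bind_seq (P Q : LPoset A) (f : A → LPoset A') :
    Isom (bind (seq P Q) f) (seq (bind P f) (bind Q f)) := by
  refine ⟨Equiv.sumSigmaDistrib fun x => (f ((seq P Q).label x)).carrier, ?_, ?_⟩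
  · rintro ⟨x | x, x'⟩ ⟨y | y, y'⟩
    · refine Sum.lex_inl_inl.trans (Sigma.lex_iff.trans (Iff.trans ?_ Sigma.lex_iff.symm))
      constructor
      · rintro (h | ⟨h, k⟩)
        · exact Or.inl (Sum.lex_inl_inl.2 h)
        · obtain rfl : x = y := h
          exact Or.inr ⟨rfl, k⟩
      · rintro (h | ⟨h, k⟩)
        · exact Or.inl (Sum.lex_inl_inl.1 h)
        · obtain rfl : x = y := Sum.inl.inj h
          exact Or.inr ⟨rfl, k⟩
    · exact iff_of_true (Sum.Lex.sep _ _) (Sigma.Lex.left _ _ (Sum.Lex.sep _ _))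
    · refine iff_of_false Sum.lex_inr_inl fun h => ?_
      rcases Sigma.lex_iff.1 h with h | ⟨h, _⟩
      · exact Sum.lex_inr_inl h
      · cases h
    · refine Sum.lex_inr_inr.trans (Sigma.lex_iff.trans (Iff.trans ?_ Sigma.lex_iff.symm))
      constructor
      · rintro (h | ⟨h, k⟩)
        · exact Or.inl (Sum.lex_inr_inr.2 h)
        · obtain rfl : x = y := h
          exact Or.inr ⟨rfl, k⟩
      · rintro (h | ⟨h, k⟩)
        · exact Or.inl (Sum.lex_inr_inr.1 h)
        · obtain rfl : x = y := Sum.inr.inj h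
          exact Or.inr ⟨rfl, k⟩
  · rintro ⟨x | x, x'⟩ <;> rfl

theorem bind_par (P Q : LPoset A) (f : A → LPoset A') :
    Isom (bind (par P Q) f) (par (bind P f) (bind Q f)) := by
  refine ⟨Equiv.sumSigmaDistrib fun x => (f ((par P Q).label x)).carrier, ?_, ?_⟩
  · rintro ⟨x | x, x'⟩ ⟨y | y, y'⟩
    · refine Sum.liftRel_inl_inl.trans (Sigma.lex_iff.trans (Iff.trans ?_ Sigma.lex_iff.symm))
      constructor
      · rintro (h | ⟨h, k⟩)
        · exact Or.inl (Sum.liftRel_inl_inl.2 h)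
        · obtain rfl : x = y := h
          exact Or.inr ⟨rfl, k⟩
      · rintro (h | ⟨h, k⟩)
        · exact Or.inl (Sum.liftRel_inl_inl.1 h)
        · obtain rfl : x = y := Sum.inl.inj h
          exact Or.inr ⟨rfl, k⟩
    · refine iff_of_false Sum.not_liftRel_inl_inr fun h => ?_
      rcases Sigma.lex_iff.1 h with h | ⟨h, _⟩
      · exact Sum.not_liftRel_inl_inr h
      · cases h
    · refine iff_of_false Sum.not_liftRel_inr_inl fun h => ?_
      rcases Sigma.lex_iff.1 h with h | ⟨h, _⟩
      · exact Sum.not_liftRel_inr_inl h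
      · cases h
    · refine Sum.liftRel_inr_inr.trans (Sigma.lex_iff.trans (Iff.trans ?_ Sigma.lex_iff.symm))
      constructor
      · rintro (h | ⟨h, k⟩)
        · exact Or.inl (Sum.liftRel_inr_inr.2 h)
        · obtain rfl : x = y := h
          exact Or.inr ⟨rfl, k⟩
      · rintro (h | ⟨h, k⟩)
        · exact Or.inl (Sum.liftRel_inr_inr.1 h)
        · obtain rfl : x = y := Sum.inr.inj h
          exact Or.inr ⟨rfl, k⟩
  · rintro ⟨x | x, x'⟩ <;> rfl

theorem bind_label_none {P : LPoset (Option A)} {f : Option A → LPoset (Option A)}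
    (hP : ∃! x, P.label x = none) (h0 : ∃! y, (f none).label y = none)
    (h1 : ∀ a y, (f (some a)).label y ≠ none) : ∃! z, (P.bind f).label z = none := by
  obtain ⟨x, hx, hx'⟩ := hP
  have h2 : ∃! y, (f (P.label x)).label y = none := by
    rw [hx]
    exact h0
  obtain ⟨y, hy, hy'⟩ := h2
  refine ⟨⟨x, y⟩, hy, ?_⟩
  rintro ⟨x₁, y₁⟩ h
  change (f (P.label x₁)).label y₁ = none at h
  have hx₁ : P.label x₁ = none := by
    cases hl : P.label x₁ with
    | none => rfl
    | some a =>
      revert y₁ h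
      rw [hl]
      exact fun y₁ h => (h1 a y₁ h).elim
  obtain rfl := hx' x₁ hx₁
  rw [hy' y₁ h]

theorem Isom.label_ne {P Q : LPoset A} (h : Isom P Q) {a : A} (hP : ∀ x, P.label x ≠ a) :
    ∀ x, Q.label x ≠ a := by
  obtain ⟨e, _, h2⟩ := h.symm
  exact fun x hx => hP (e x) ((h2 x).trans hx)

theorem Isom.label_unique {P Q : LPoset A} (h : Isom P Q) {a : A} (hP : ∃! x, P.label x = a) :
    ∃! x, Q.label x = a := by
  obtain ⟨e, _, h2⟩ := h
  obtain ⟨x, hx, hx'⟩ := hP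
  refine ⟨e x, (h2 x).trans hx, fun y hy => ?_⟩
  have h3 := hx' (e.symm y) (by
    change P.label (e.symm y) = a
    rw [← h2, e.apply_symm_apply]
    exact hy)
  rw [← h3, e.apply_symm_apply]

end LPoset

/-- A pomset is an isomorphism class of finite labelled posets. -/
def Pomset (A : Type u) : Type (max u 1) := Quotient (LPoset.setoid A)

namespace Pomset

variable {A : Type u} {A' : Type v}

def mk (P : LPoset A) : Pomset A := Quotient.mk _ P

theorem mk_eq {P Q : LPoset A} (h : LPoset.Isom P Q) : mk P = mk Q := Quotient.sound h

def empty : Pomset A := mk LPoset.empty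

def single (a : A) : Pomset A := mk (LPoset.single a)

def seq (p q : Pomset A) : Pomset A :=
  Quotient.liftOn₂ p q (fun P Q => mk (P.seq Q))
    fun _ _ _ _ h k => mk_eq (LPoset.seq_isom h k)

def par (p q : Pomset A) : Pomset A :=
  Quotient.liftOn₂ p q (fun P Q => mk (P.par Q))
    fun _ _ _ _ h k => mk_eq (LPoset.par_isom h k)

/-- Substitution: every `a`-labelled element of `p` is replaced by a copy of `f a`. -/
noncomputable def bind (p : Pomset A) (f : A → Pomset A') : Pomset A' :=
  Quotient.liftOn p (fun P => mk (P.bind fun a => (f a).out))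
    fun _ _ h => mk_eq (LPoset.bind_isom h _)

theorem bind_empty (f : A → Pomset A') : bind empty f = empty :=
  mk_eq (LPoset.bind_empty _)

theorem bind_single (a : A) (f : A → Pomset A') : bind (single a) f = f a :=
  (mk_eq (LPoset.bind_single a _)).trans (Quotient.out_eq (f a))

theorem bind_seq (p q : Pomset A) (f : A → Pomset A') :
    bind (seq p q) f = seq (bind p f) (bind q f) :=
  Quotient.inductionOn₂ p q fun _ _ => mk_eq (LPoset.bind_seq _ _ _)

theorem bind_par (p q : Pomset A) (f : A → Pomset A') :
    bind (par p q) f = par (bind p f) (bind q f) :=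
  Quotient.inductionOn₂ p q fun _ _ => mk_eq (LPoset.bind_par _ _ _)

/-- The least class of pomsets that contains the empty pomset and the singletons and is closed
under sequential and parallel composition. -/
inductive IsSP : Pomset A → Prop
  | empty : IsSP empty
  | single (a : A) : IsSP (single a)
  | seq {p q : Pomset A} : IsSP p → IsSP q → IsSP (seq p q)
  | par {p q : Pomset A} : IsSP p → IsSP q → IsSP (par p q)

theorem IsSP.bind {p : Pomset A} {f : A → Pomset A'} (hp : IsSP p) (hf : ∀ a, IsSP (f a)) :
    IsSP (p.bind f) := by
  induction hp with
  | empty => rw [bind_empty]; exact .empty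
  | single a => rw [bind_single]; exact hf a
  | seq _ _ h k => rw [bind_seq]; exact .seq h k
  | par _ _ h k => rw [bind_par]; exact .par h k

theorem out_mk (P : LPoset A) : LPoset.Isom P (mk P).out :=
  LPoset.Isom.symm (Quotient.mk_out P)

/-- Exactly one element of the pomset carries the label `a`. -/
def ExactlyOne (a : A) (p : Pomset A) : Prop :=
  ∃ P : LPoset A, mk P = p ∧ ∃! x, P.label x = a

theorem ExactlyOne.bind {c : Pomset (Option A)} {f : Option A → Pomset (Option A)}
    (hc : ExactlyOne none c) (h0 : ExactlyOne none (f none))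
    (h1 : ∀ a, f (some a) = single (some a)) : ExactlyOne none (c.bind f) := by
  obtain ⟨P, rfl, hP⟩ := hc
  obtain ⟨Q, hQ, hQ'⟩ := h0
  refine ⟨_, rfl, LPoset.bind_label_none hP ?_ fun a => ?_⟩
  · rw [← hQ]
    exact (out_mk Q).label_unique hQ'
  · rw [h1]
    exact (out_mk (LPoset.single (some a))).label_ne fun _ => Option.some_ne_none _

end Pomset

/-- The two composition operators. -/
inductive Op
  | seq
  | par

/-! ## Series-parallel pomsets -/

/-- Series-parallel pomsets over the alphabet `A`. -/
def SP (A : Type u) : Type (max u 1) := {p : Pomset A // p.IsSP}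

namespace SP

variable {A : Type u} {A' : Type v}

def empty : SP A := ⟨Pomset.empty, .empty⟩

def letter (a : A) : SP A := ⟨Pomset.single a, .single a⟩

/-- The composition `p ∘ q` for either operator. -/
def op : Op → SP A → SP A → SP A
  | .seq, p, q => ⟨p.1.seq q.1, .seq p.2 q.2⟩
  | .par, p, q => ⟨p.1.par q.1, .par p.2 q.2⟩

noncomputable def bind (p : SP A) (f : A → SP A') : SP A' :=
  ⟨p.1.bind fun a => (f a).1, p.2.bind fun a => (f a).2⟩

end SP

/-- Syntactic terms: binary trees with inner nodes labelled by operators and leaves labelled by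
letters or by the empty pomset. -/
inductive Term (A : Type u) : Type u
  | eps
  | letter (a : A)
  | node (o : Op) (s t : Term A)

namespace Term

variable {A : Type u}

/-- The pomset described by a term. -/
def denote : Term A → SP A
  | eps => SP.empty
  | letter a => SP.letter a
  | node o s t => SP.op o s.denote t.denote

def depth : Term A → ℕ
  | eps => 0
  | letter _ => 0
  | node _ s t => max s.depth t.depth + 1

def EpsFree : Term A → Prop
  | eps => False
  | letter _ => True
  | node _ s t => s.EpsFree ∧ t.EpsFree

/-- A canonical term of `w`: it describes `w`, has minimal depth among the terms that do, and has
no leaf labelled by the empty pomset unless `w` is empty. -/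
def IsCanonical (t : Term A) (w : SP A) : Prop :=
  t.denote = w ∧ (∀ s : Term A, s.denote = w → t.depth ≤ s.depth) ∧ (w ≠ SP.empty → t.EpsFree)

end Term

/-- `z = z₁ ∘ z₂` is a canonical decomposition: some canonical term of `z` has root `∘` and
its two subtrees describe `z₁` and `z₂`. -/
def CanonicalDecomposition {A : Type u} (z : SP A) (o : Op) (z₁ z₂ : SP A) : Prop :=
  ∃ t₁ t₂ : Term A, (Term.node o t₁ t₂).IsCanonical z ∧ t₁.denote = z₁ ∧ t₂.denote = z₂

/-! ## Contexts -/

/-- A context: a series-parallel pomset over `A` extended by the placeholder `none`, with exactly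
one element labelled by the placeholder. -/
def Context (A : Type u) : Type (max u 1) :=
  {c : SP (Option A) // c.1.ExactlyOne none}

namespace Context

variable {A : Type u}

/-- The pomset `c[w]`. -/
noncomputable def fill (c : Context A) (w : SP A) : SP A :=
  c.1.bind fun x => x.elim w SP.letter

/-- The trivial context `□`. -/
def hole : Context A :=
  ⟨SP.letter none, LPoset.single none, rfl, (), rfl, fun _ _ => rfl⟩

/-- A pomset over `A`, regarded as a pomset over the extended alphabet. -/
noncomputable def embed (z : SP A) : SP (Option A) := z.bind fun a => SP.letter (some a)

theorem label_embed (z : SP A) : ∃ P : LPoset (Option A),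
    Pomset.mk P = (embed z).1 ∧ ∀ x, P.label x ≠ none := by
  obtain ⟨z, hz⟩ := z
  induction z using Quotient.inductionOn with
  | h Q =>
    refine ⟨_, rfl, ?_⟩
    rintro ⟨x, y⟩
    exact (Pomset.out_mk (LPoset.single (some (Q.label x)))).label_ne
      (fun _ => Option.some_ne_none _) y

/-- The context `□ ∘ z`. -/
noncomputable def holeLeft (o : Op) (z : SP A) : Context A :=
  ⟨SP.op o (SP.letter none) (embed z), by
    obtain ⟨P, hP, h⟩ := label_embed z
    cases o with
    | seq =>
      refine ⟨(LPoset.single none).seq P, congrArg (Pomset.seq (Pomset.single none)) hP,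
        Sum.inl (), rfl, ?_⟩
      rintro (x | x) hx
      · rfl
      · exact (h x hx).elim
    | par =>
      refine ⟨(LPoset.single none).par P, congrArg (Pomset.par (Pomset.single none)) hP,
        Sum.inl (), rfl, ?_⟩
      rintro (x | x) hx
      · rfl
      · exact (h x hx).elim⟩

/-- The context `z ∘ □`. -/
noncomputable def holeRight (o : Op) (z : SP A) : Context A :=
  ⟨SP.op o (embed z) (SP.letter none), by
    obtain ⟨P, hP, h⟩ := label_embed z
    cases o with
    | seq =>
      refine ⟨P.seq (LPoset.single none),
        congrArg (fun p => Pomset.seq p (Pomset.single none)) hP, Sum.inr (), rfl, ?_⟩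
      rintro (x | x) hx
      · exact (h x hx).elim
      · rfl
    | par =>
      refine ⟨P.par (LPoset.single none),
        congrArg (fun p => Pomset.par p (Pomset.single none)) hP, Sum.inr (), rfl, ?_⟩
      rintro (x | x) hx
      · exact (h x hx).elim
      · rfl⟩

/-- The context `c[d]`. -/
noncomputable def comp (c d : Context A) : Context A :=
  ⟨c.1.bind fun x => x.elim d.1 fun a => SP.letter (some a),
    c.2.bind d.2 fun _ => rfl⟩

end Context

/-! ## Pomset recognizers -/

/-- A pomset recognizer over `A` with set of states `M`: a finite bimonoid structure on `M` (two
associative operations with a common neutral element, the one for `Op.par` being commutative), an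
image in `M` of every letter, and a set of accepting states. -/
structure Recognizer (A : Type u) (M : Type v) : Type (max u v) where
  finite : Finite M
  op : Op → M → M → M
  one : M
  assoc : ∀ o x y z, op o (op o x y) z = op o x (op o y z)
  par_comm : ∀ x y, op .par x y = op .par y x
  one_op : ∀ o x, op o one x = x
  op_one : ∀ o x, op o x one = x
  init : A → M
  final : Set M

namespace Recognizer

variable {A : Type u} {M : Type v}

/-- The graph of the evaluation homomorphism `SP A → M` that extends `init`. -/
inductive Eval (R : Recognizer A M) : SP A → M → Prop
  | empty : Eval R SP.empty R.one
  | letter (a : A) : Eval R (SP.letter a) (R.init a)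
  | op (o : Op) {p q : SP A} {x y : M} :
      Eval R p x → Eval R q y → Eval R (SP.op o p q) (R.op o x y)

/-- The language of a recognizer. -/
def language (R : Recognizer A M) : Set (SP A) := {w | ∃ x ∈ R.final, R.Eval w x}

end Recognizer

/-- A language of series-parallel pomsets is recognizable if it is the language of some pomset
recognizer. (States may be taken in `Type` as they form a finite set.) -/
def IsRecognizable {A : Type u} (L : Set (SP A)) : Prop :=
  ∃ (M : Type) (R : Recognizer A M), R.language = L

/-! ## Discrimination trees -/

/-- A component is a finite set of pomsets. -/
abbrev Component (A : Type u) : Type (max u 1) := Finset (SP A)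

/-- Discrimination trees. Inner nodes are labelled by contexts; a leaf is either unlabelled or
labelled by a component. The pack of components is the set of all leaf labels. -/
inductive DTree (A : Type u) : Type (max u 1)
  | leaf (B : Option (Component A))
  | node (c : Context A) (l r : DTree A)

namespace DTree

variable {A : Type u}

open Classical in
/-- The pack of components: the labels of the labelled leaves. -/
noncomputable def pack : DTree A → Finset (Component A)
  | leaf none => ∅
  | leaf (some B) => {B}
  | node _ l r => l.pack ∪ r.pack

/-- The set of contexts labelling the inner nodes. -/
def contexts : DTree A → Set (Context A)
  | leaf _ => ∅
  | node c l r => {c} ∪ (l.contexts ∪ r.contexts)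

/-- The set of contexts on the branch from the root to the leaf labelled by `B`. -/
def branchContexts : DTree A → Component A → Set (Context A)
  | leaf _, _ => ∅
  | node c l r, B =>
      {c' | (c' = c ∧ (B ∈ l.pack ∨ B ∈ r.pack)) ∨
        c' ∈ l.branchContexts B ∨ c' ∈ r.branchContexts B}

open Classical in
/-- Sifting `w`: branch right at a node labelled `c` if `c[w] ∈ L` and left otherwise. The result
is the label of the leaf that is reached, and `none` if that leaf is unlabelled. -/
noncomputable def sift (L : Set (SP A)) (w : SP A) : DTree A → Option (Component A)
  | leaf B => B
  | node c l r => if c.fill w ∈ L then r.sift L w else l.sift L w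

open Classical in
/-- Adds `w` to the component of the leaf into which `w` is sifted; an unlabelled leaf becomes
labelled by the new component `{w}`. -/
noncomputable def insert (L : Set (SP A)) (w : SP A) : DTree A → DTree A
  | leaf none => leaf (some {w})
  | leaf (some B) => leaf (some (Insert.insert w B))
  | node c l r => if c.fill w ∈ L then node c l (r.insert L w) else node c (l.insert L w) r

open Classical in
/-- Replaces the leaf labelled by `B` with an inner node labelled by `c` whose left and right
children are leaves labelled by `B₀` and `B₁`. -/
noncomputable def refine (B : Component A) (c : Context A) (B₀ B₁ : Component A) :
    DTree A → DTree A
  | leaf B' => if B' = some B then node c (leaf (some B₀)) (leaf (some B₁)) else leaf B'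
  | node c' l r => node c' (l.refine B c B₀ B₁) (r.refine B c B₀ B₁)

/-- The initial tree: a root labelled by `□` with two unlabelled leaves. -/
def initial : DTree A := node Context.hole (leaf none) (leaf none)

end DTree

/-! ## The learner -/

/-- A hypothesis: a pomset recognizer whose states are the components of a pack. -/
structure Hypothesis (A : Type u) : Type (max u 1) where
  pack : Finset (Component A)
  recognizer : Recognizer A {B : Component A // B ∈ pack}

namespace Hypothesis

variable {A : Type u}

/-- The language of a hypothesis. -/
def language (H : Hypothesis A) : Set (SP A) := H.recognizer.language

/-- `H` and the target language `L` agree on `w`, i.e. `H(w) = M(w)`. -/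
def AgreesOn (L : Set (SP A)) (H : Hypothesis A) (w : SP A) : Prop := w ∈ H.language ↔ w ∈ L

end Hypothesis

/-- The data maintained by the learner: the access sequences `S`, the discrimination tree
together with the pack of components on its leaves, the current hypothesis (`none` before the
first one has been built), and the pool of counter-examples. -/
structure Store (A : Type u) : Type (max u 1) where
  S : Finset (SP A)
  tree : DTree A
  hyp : Option (Hypothesis A)
  pool : Finset (SP A)

namespace Store

variable {A : Type u}

/-- The access sequences of the component to which `w` belongs. -/
def access (st : Store A) (w : SP A) : Set (SP A) :=
  {p | p ∈ st.S ∧ ∃ B ∈ st.tree.pack, w ∈ B ∧ p ∈ B}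

/-- The access sequences of the component to which `w` evaluates in the hypothesis `H`. -/
def hypAccess (st : Store A) (H : Hypothesis A) (w : SP A) : Set (SP A) :=
  {p | p ∈ st.S ∧ ∃ B, H.recognizer.Eval w B ∧ p ∈ B.1}

/-- The agreement predicate: `H(c[p]) = M(c[p])` for all access sequences `p` of `z` in `H`. -/
def Agree (L : Set (SP A)) (st : Store A) (H : Hypothesis A) (c : Context A) (z : SP A) : Prop :=
  ∀ p ∈ st.hypAccess H z, H.AgreesOn L (c.fill p)

/-- `H` is the hypothesis built from `S` and the pack of components: its states are all the
components, `B_u ∘ B_v = B_{u ∘ v}` for `u, v ∈ S`, the neutral element is the component of the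
empty pomset, a letter is sent to its component, and the accepting components are those
contained in `L`. -/
def IsHypothesis (L : Set (SP A)) (st : Store A) (H : Hypothesis A) : Prop :=
  H.pack = st.tree.pack ∧
  (∀ (o : Op) (B₁ B₂ : {B : Component A // B ∈ H.pack}), ∀ u ∈ st.S, ∀ v ∈ st.S,
    u ∈ B₁.1 → v ∈ B₂.1 → SP.op o u v ∈ (H.recognizer.op o B₁ B₂).1) ∧
  SP.empty ∈ H.recognizer.one.1 ∧
  (∀ a, SP.letter a ∈ (H.recognizer.init a).1) ∧
  H.recognizer.final = {B | ∀ s ∈ B.1, s ∈ L}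

/-- The components `D(u)` and `D(v)` differ. -/
def Separated (L : Set (SP A)) (st : Store A) (u v : SP A) : Prop :=
  st.tree.sift L u ≠ st.tree.sift L v

/-- A consistency defect: `p₁` and `p₂` are access sequences of the component `B`, and `p ∈ S` is
such that `u = p₁ ∘ p` and `v = p₂ ∘ p` lie in different components, where `e = □ ∘ p`; or the
same with `u = p ∘ p₁`, `v = p ∘ p₂` and `e = p ∘ □`. -/
inductive ConsistencyDefect (L : Set (SP A)) (st : Store A) :
    Component A → SP A → SP A → Context A → Prop
  | left (o : Op) (B : Component A) (p₁ p₂ p : SP A) :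
      B ∈ st.tree.pack → p₁ ∈ st.S → p₁ ∈ B → p₂ ∈ st.S → p₂ ∈ B → p ∈ st.S →
      st.Separated L (SP.op o p₁ p) (SP.op o p₂ p) →
      ConsistencyDefect L st B (SP.op o p₁ p) (SP.op o p₂ p) (Context.holeLeft o p)
  | right (o : Op) (B : Component A) (p₁ p₂ p : SP A) :
      B ∈ st.tree.pack → p₁ ∈ st.S → p₁ ∈ B → p₂ ∈ st.S → p₂ ∈ B → p ∈ st.S →
      st.Separated L (SP.op o p p₁) (SP.op o p p₂) →
      ConsistencyDefect L st B (SP.op o p p₁) (SP.op o p p₂) (Context.holeRight o p)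

/-- An associativity defect: `s₁, s₂, s₃ ∈ S`, `sl` is an access sequence of the component of
`s₁ ∘ s₂`, `sr` is one of the component of `s₂ ∘ s₃`, and `s₁ ∘ sr`, `sl ∘ s₃` lie in different
components. -/
def AssocDefect (L : Set (SP A)) (st : Store A) (o : Op) (s₁ s₂ s₃ sl sr : SP A) : Prop :=
  s₁ ∈ st.S ∧ s₂ ∈ st.S ∧ s₃ ∈ st.S ∧
  sl ∈ st.access (SP.op o s₁ s₂) ∧ sr ∈ st.access (SP.op o s₂ s₃) ∧
  st.Separated L (SP.op o s₁ sr) (SP.op o sl s₃)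

open Classical in
/-- The part of the component `B` whose members `w` satisfy `c[w] ∉ L`. -/
noncomputable def part₀ (L : Set (SP A)) (B : Component A) (c : Context A) : Component A :=
  B.filter fun w => c.fill w ∉ L

open Classical in
/-- The part of the component `B` whose members `w` satisfy `c[w] ∈ L`. -/
noncomputable def part₁ (L : Set (SP A)) (B : Component A) (c : Context A) : Component A :=
  B.filter fun w => c.fill w ∈ L

open Classical in
/-- Adds `w` to the access sequences. -/
noncomputable def addAccess (st : Store A) (w : SP A) : Store A :=
  { st with S := insert w st.S }

open Classical in
/-- The compositions `w ∘ p` and `p ∘ w` for `p ∈ S` and both operators. -/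
noncomputable def compositions (st : Store A) (w : SP A) : Finset (SP A) :=
  st.S.image (SP.op .seq w) ∪ st.S.image (fun p => SP.op .seq p w) ∪
    (st.S.image (SP.op .par w) ∪ st.S.image (fun p => SP.op .par p w))

open Classical in
/-- Adds `c[p]` and all `c[p']`, for `p'` an access sequence of `p` in `H`, to the pool. -/
noncomputable def addPool (st : Store A) (H : Hypothesis A) (c : Context A) (p : SP A) : Store A :=
  { st with
    pool := st.pool ∪ {c.fill p} ∪ (st.S.filter fun p' => p' ∈ st.hypAccess H p).image c.fill }

end Store

open Classical in
/-- The letters, as one-element pomsets. -/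
noncomputable def letters (A : Type u) [Fintype A] : Finset (SP A) :=
  Finset.univ.image SP.letter

/-- Control points of the algorithm. A configuration carries a stack of them: the work that
remains to be done, the next item first. -/
inductive Control (A : Type u) : Type (max u 1)
  /-- Call `Expand(w)`. -/
  | expand (w : SP A)
  /-- Remaining iterations of (one block of) the loop of `Expand`. -/
  | expandLoop (todo : Finset (SP A))
  /-- Call `Refine(B, c)`. -/
  | refine (B : Component A) (c : Context A)
  /-- The test at the end of `Refine` whether the new component has an access sequence. -/
  | ensureAccess (B : Component A)
  /-- Head of the loop of `MakeConsistent`, with the flag `already_consistent`. -/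
  | makeConsistent (already : Bool)
  /-- Head of the loop of `MakeAssoc`, with the flag `already_assoc` and the value returned by
  the preceding call of `MakeConsistent`. -/
  | makeAssoc (consistent already : Bool)
  /-- `BuildHypothesis(S, B)`. -/
  | buildHypothesis
  /-- Call `FindEBP(c, z)`. -/
  | findEBP (c : Context A) (z : SP A)
  /-- `FindEBP` has returned the pair `(c, p)` to `HandleCE`. -/
  | foundEBP (c : Context A) (p : SP A)
  /-- Call `HandleCE(w)`. -/
  | handleCE (w : SP A)
  /-- Head of the loop of `HandleCE`. -/
  | handleLoop
  /-- Head of the outer loop of `Learn`: an equivalence query. -/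
  | mainLoop
  /-- Head of the inner loop of `Learn`, which makes the hypothesis compatible. -/
  | compatLoop

/-- A configuration: the learner is running, with a control stack and a store, or it has returned
a hypothesis. -/
inductive Config (A : Type u) : Type (max u 1)
  | running (stack : List (Control A)) (st : Store A)
  | returned (H : Hypothesis A)

open Control Config Store in
/-- One step of the learner for the target language `L`. A membership query for `w` is answered
by whether `w ∈ L`. An equivalence query for `H` is answered positively if `H` has language `L`,
and by an arbitrary counter-example otherwise. Every choice that the algorithm leaves open is
nondeterministic. -/
inductive Step {A : Type u} [Fintype A] (L : Set (SP A)) : Config A → Config A → Prop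
  -- Expand(w)
  | expand (w : SP A) (k : List (Control A)) (st : Store A) :
      Step L (running (.expand w :: k) st)
        (running (expandLoop {w} :: expandLoop ((st.addAccess w).compositions w) ::
          expandLoop (letters A) :: k) (st.addAccess w))
  | expand_done (k : List (Control A)) (st : Store A) :
      Step L (running (expandLoop ∅ :: k) st) (running k st)
  | expand_known (p : SP A) (todo todo' : Finset (SP A)) (k : List (Control A)) (st : Store A) :
      p ∈ todo → (∀ x, x ∈ todo' ↔ x ∈ todo ∧ x ≠ p) →
      (∃ B ∈ st.tree.pack, p ∈ B) →
      Step L (running (expandLoop todo :: k) st) (running (expandLoop todo' :: k) st)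
  | expand_insert (p : SP A) (todo todo' : Finset (SP A)) (k : List (Control A)) (st : Store A)
      (B : Component A) :
      p ∈ todo → (∀ x, x ∈ todo' ↔ x ∈ todo ∧ x ≠ p) →
      (¬ ∃ B ∈ st.tree.pack, p ∈ B) → st.tree.sift L p = some B →
      Step L (running (expandLoop todo :: k) st)
        (running (expandLoop todo' :: k) { st with tree := st.tree.insert L p })
  | expand_new (p : SP A) (todo todo' : Finset (SP A)) (k : List (Control A)) (st : Store A) :
      p ∈ todo → (∀ x, x ∈ todo' ↔ x ∈ todo ∧ x ≠ p) →
      (¬ ∃ B ∈ st.tree.pack, p ∈ B) → st.tree.sift L p = none →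
      Step L (running (expandLoop todo :: k) st)
        (running (.expand p :: expandLoop todo' :: k) { st with tree := st.tree.insert L p })
  -- Refine(B, c); the first three premises are its precondition
  | refine (B : Component A) (c : Context A) (z₁ z₂ : SP A) (k : List (Control A)) (st : Store A) :
      B ∈ st.tree.pack → z₁ ∈ B → z₂ ∈ B → ¬ (c.fill z₁ ∈ L ↔ c.fill z₂ ∈ L) →
      Step L (running (.refine B c :: k) st)
        (running (ensureAccess (part₀ L B c) :: ensureAccess (part₁ L B c) :: k)
          { st with tree := st.tree.refine B c (part₀ L B c) (part₁ L B c) })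
  -- `B'` is the present value of the component whose value was `B` when `Refine` split
  | ensure_skip (B B' : Component A) (s : SP A) (k : List (Control A)) (st : Store A) :
      B' ∈ st.tree.pack → B ⊆ B' → s ∈ st.S → s ∈ B' →
      Step L (running (ensureAccess B :: k) st) (running k st)
  | ensure_expand (B B' : Component A) (p : SP A) (k : List (Control A)) (st : Store A) :
      B' ∈ st.tree.pack → B ⊆ B' → (∀ s ∈ st.S, s ∉ B') → p ∈ B' →
      Step L (running (ensureAccess B :: k) st) (running (.expand p :: k) st)
  -- MakeConsistent()
  | consistent_refine (B : Component A) (u v : SP A) (c e : Context A) (already : Bool)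
      (k : List (Control A)) (st : Store A) :
      st.ConsistencyDefect L B u v e → c ∈ st.tree.contexts →
      ¬ (c.fill u ∈ L ↔ c.fill v ∈ L) →
      Step L (running (makeConsistent already :: k) st)
        (running (.refine B (c.comp e) :: makeConsistent false :: k) st)
  | consistent_done (already : Bool) (k : List (Control A)) (st : Store A) :
      (¬ ∃ B u v e, st.ConsistencyDefect L B u v e) →
      Step L (running (makeConsistent already :: k) st)
        (running (makeAssoc already true :: k) st)
  -- short-circuit evaluation of the exit test `MakeConsistent() ∧ MakeAssoc()` is allowed as well
  | consistent_again (k : List (Control A)) (st : Store A) :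
      (¬ ∃ B u v e, st.ConsistencyDefect L B u v e) →
      Step L (running (makeConsistent false :: k) st) (running (makeConsistent true :: k) st)
  -- MakeAssoc()
  | assoc_left (o : Op) (s₁ s₂ s₃ sl sr : SP A) (c : Context A) (B : Component A)
      (consistent already : Bool) (k : List (Control A)) (st : Store A) :
      st.AssocDefect L o s₁ s₂ s₃ sl sr → c ∈ st.tree.contexts →
      ¬ (c.fill (SP.op o s₁ sr) ∈ L ↔ c.fill (SP.op o sl s₃) ∈ L) →
      ¬ (c.fill (SP.op o sl s₃) ∈ L ↔ c.fill (SP.op o (SP.op o s₁ s₂) s₃) ∈ L) →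
      B ∈ st.tree.pack → SP.op o s₁ s₂ ∈ B →
      Step L (running (makeAssoc consistent already :: k) st)
        (running (.refine B (c.comp (Context.holeLeft o s₃)) :: makeAssoc consistent false :: k) st)
  | assoc_right (o : Op) (s₁ s₂ s₃ sl sr : SP A) (c : Context A) (B : Component A)
      (consistent already : Bool) (k : List (Control A)) (st : Store A) :
      st.AssocDefect L o s₁ s₂ s₃ sl sr → c ∈ st.tree.contexts →
      ¬ (c.fill (SP.op o s₁ sr) ∈ L ↔ c.fill (SP.op o sl s₃) ∈ L) →
      (c.fill (SP.op o sl s₃) ∈ L ↔ c.fill (SP.op o (SP.op o s₁ s₂) s₃) ∈ L) →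
      B ∈ st.tree.pack → SP.op o s₂ s₃ ∈ B →
      Step L (running (makeAssoc consistent already :: k) st)
        (running (.refine B (c.comp (Context.holeRight o s₁)) :: makeAssoc consistent false :: k) st)
  | assoc_done (k : List (Control A)) (st : Store A) :
      (¬ ∃ o s₁ s₂ s₃ sl sr, st.AssocDefect L o s₁ s₂ s₃ sl sr) →
      Step L (running (makeAssoc true true :: k) st) (running k st)
  | assoc_again (consistent already : Bool) (k : List (Control A)) (st : Store A) :
      (¬ ∃ o s₁ s₂ s₃ sl sr, st.AssocDefect L o s₁ s₂ s₃ sl sr) →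
      (consistent && already) = false →
      Step L (running (makeAssoc consistent already :: k) st)
        (running (makeConsistent true :: k) st)
  -- BuildHypothesis(S, B)
  | build (H : Hypothesis A) (k : List (Control A)) (st : Store A) :
      st.IsHypothesis L H →
      Step L (running (buildHypothesis :: k) st) (running k { st with hyp := some H })
  -- FindEBP(c, z)
  | ebp_letter (c : Context A) (a : A) (k : List (Control A)) (st : Store A) :
      Step L (running (findEBP c (SP.letter a) :: k) st)
        (running (foundEBP c (SP.letter a) :: k) st)
  | ebp_left (H : Hypothesis A) (c : Context A) (z : SP A) (o : Op) (z₁ z₂ : SP A)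
      (k : List (Control A)) (st : Store A) :
      st.hyp = some H → CanonicalDecomposition z o z₁ z₂ →
      st.Agree L H (c.comp (Context.holeLeft o z₂)) z₁ →
      Step L (running (findEBP c z :: k) st)
        (running (findEBP (c.comp (Context.holeLeft o z₂)) z₁ :: k) st)
  | ebp_right (H : Hypothesis A) (c : Context A) (z : SP A) (o : Op) (z₁ z₂ p₁ : SP A)
      (k : List (Control A)) (st : Store A) :
      st.hyp = some H → CanonicalDecomposition z o z₁ z₂ →
      ¬ st.Agree L H (c.comp (Context.holeLeft o z₂)) z₁ →
      p₁ ∈ st.hypAccess H z₁ → ¬ H.AgreesOn L (c.fill (SP.op o p₁ z₂)) →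
      st.Agree L H (c.comp (Context.holeRight o p₁)) z₂ →
      Step L (running (findEBP c z :: k) st)
        (running (findEBP (c.comp (Context.holeRight o p₁)) z₂ :: k) st)
  | ebp_found (H : Hypothesis A) (c : Context A) (z : SP A) (o : Op) (z₁ z₂ p₁ p₂ : SP A)
      (k : List (Control A)) (st : Store A) :
      st.hyp = some H → CanonicalDecomposition z o z₁ z₂ →
      ¬ st.Agree L H (c.comp (Context.holeLeft o z₂)) z₁ →
      p₁ ∈ st.hypAccess H z₁ → ¬ H.AgreesOn L (c.fill (SP.op o p₁ z₂)) →
      ¬ st.Agree L H (c.comp (Context.holeRight o p₁)) z₂ →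
      p₂ ∈ st.hypAccess H z₂ → ¬ H.AgreesOn L (c.fill (SP.op o p₁ p₂)) →
      Step L (running (findEBP c z :: k) st) (running (foundEBP c (SP.op o p₁ p₂) :: k) st)
  -- HandleCE(w)
  | handle (w : SP A) (k : List (Control A)) (st : Store A) :
      Step L (running (handleCE w :: k) st) (running (handleLoop :: k) { st with pool := {w} })
  | handle_find (H : Hypothesis A) (u : SP A) (k : List (Control A)) (st : Store A) :
      st.hyp = some H → u ∈ st.pool → ¬ H.AgreesOn L u →
      Step L (running (handleLoop :: k) st)
        (running (findEBP Context.hole u :: handleLoop :: k) st)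
  | handle_found (H : Hypothesis A) (c : Context A) (p : SP A) (k : List (Control A))
      (st : Store A) :
      st.hyp = some H →
      Step L (running (foundEBP c p :: k) st)
        (running (.expand p :: makeConsistent true :: buildHypothesis :: k) (st.addPool H c p))
  | handle_done (H : Hypothesis A) (k : List (Control A)) (st : Store A) :
      st.hyp = some H → (∀ u ∈ st.pool, H.AgreesOn L u) →
      Step L (running (handleLoop :: k) st) (running k st)
  -- Learn(): equivalence query with a counter-example `w` as answer
  | learn_counterexample (H : Hypothesis A) (w : SP A) (k : List (Control A)) (st : Store A) :
      st.hyp = some H → ¬ H.AgreesOn L w →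
      Step L (running (mainLoop :: k) st)
        (running (handleCE w :: compatLoop :: mainLoop :: k) st)
  | compat_handle (H : Hypothesis A) (B : Component A) (s : SP A) (c : Context A)
      (k : List (Control A)) (st : Store A) :
      st.hyp = some H → B ∈ st.tree.pack → s ∈ B → c ∈ st.tree.branchContexts B →
      ¬ H.AgreesOn L (c.fill s) →
      Step L (running (compatLoop :: k) st) (running (handleCE (c.fill s) :: compatLoop :: k) st)
  | compat_done (H : Hypothesis A) (k : List (Control A)) (st : Store A) :
      st.hyp = some H →
      (∀ B ∈ st.tree.pack, ∀ s ∈ B, ∀ c ∈ st.tree.branchContexts B, H.AgreesOn L (c.fill s)) →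
      Step L (running (compatLoop :: k) st) (running k st)
  -- Learn(): equivalence query with a positive answer
  | learn_return (H : Hypothesis A) (st : Store A) :
      st.hyp = some H → H.language = L →
      Step L (running [mainLoop] st) (returned H)

/-- The initial configuration of `Learn()`: no access sequences, no components, a tree with root
`□` and two unlabelled leaves; the pending instructions are `Expand(ε)`, the construction of the
first hypothesis, and the main loop. -/
def Config.initial (A : Type u) : Config A :=
  .running [.expand SP.empty, .buildHypothesis, .mainLoop]
    { S := ∅, tree := DTree.initial, hyp := none, pool := ∅ }

end PomsetLearning

/-! Termination. Let `κ` be evaluation in a recognizer of the target language, with finite state set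
`M`. Pomsets with equal `κ`-value can be exchanged in every context without changing membership in
`L` (`IsRecognizable.exists_invariant`). This bounds two quantities by `|M|`: the number of
`κ`-values taken on `S`, and the number of labelled leaves of the tree, since leaves carry nonempty
components and any two of them are separated by a context (`DTree.WF.leafCount_le`). Neither
quantity ever decreases, so their sum can grow at most `2|M|` times.

It does keep growing. `Refine` splits a leaf, and opening a component labels one. The decisive case
is a counter-example (`Ready.fresh`): `FindEBP` ends with `H(c[p]) ≠ M(c[p])` although `agree(c,p)`
holds. If some `s ∈ S` had the `κ`-value of `p`, then `s` and `p` would sift to the same leaf and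
evaluate in `H` to the same component, so `H(c[p]) = H(c[s]) = M(c[s]) = M(c[p])`, a contradiction.
Thus expanding `p` adds a new `κ`-value to `S`. Between two such events only bookkeeping happens,
which a lexicographic measure controls (`Inv.decreases`).

No run gets stuck (`Inv.exists_step`). The invariant `WorkInv` says that `S`, the letters and all
compositions of access sequences are in components or still queued, and that every component has an
access sequence or is queued to get one. With an empty queue and no consistency or associativity
defect, the product of representatives defines a recognizer (`WorkInv.exists_isHypothesis`). The
first hypothesis is built without any defect check; at that time `S` holds `ε` and at most one more
pomset, which rules defects out (`FirstPhase`). `FindEBP` cannot meet `ε`, because `ε` is its own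
access sequence.

Correctness of the result is immediate, since only a positive equivalence query leads to a return.

All of this needs evaluation to be a function on pomsets although terms are not unique
(`Recognizer.Eval.unique`). Two decompositions of one poset are compared by intersecting their
factors: either both operators are parallel, and commutativity applies, or enough intersections are
empty for the neutral element to make the interchange law true. -/

namespace PomsetLearning

/-! ## Algebraic laws of series-parallel pomsets -/

namespace LPoset

variable {A : Type*}

theorem seq_assoc (P Q R : LPoset A) : Isom (seq (seq P Q) R) (seq P (seq Q R)) := by
  have key : ∀ x y : (P.carrier ⊕ Q.carrier) ⊕ R.carrier,
      Sum.Lex P.lt (Sum.Lex Q.lt R.lt) (Equiv.sumAssoc _ _ _ x) (Equiv.sumAssoc _ _ _ y) ↔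
        Sum.Lex (Sum.Lex P.lt Q.lt) R.lt x y := by
    rintro ((x | x) | x) ((y | y) | y) <;> simp
  exact ⟨Equiv.sumAssoc _ _ _, key, by rintro ((x | x) | x) <;> rfl⟩

theorem par_assoc (P Q R : LPoset A) : Isom (par (par P Q) R) (par P (par Q R)) := by
  have key : ∀ x y : (P.carrier ⊕ Q.carrier) ⊕ R.carrier,
      Sum.LiftRel P.lt (Sum.LiftRel Q.lt R.lt) (Equiv.sumAssoc _ _ _ x)
        (Equiv.sumAssoc _ _ _ y) ↔ Sum.LiftRel (Sum.LiftRel P.lt Q.lt) R.lt x y := by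
    rintro ((x | x) | x) ((y | y) | y) <;> simp
  exact ⟨Equiv.sumAssoc _ _ _, key, by rintro ((x | x) | x) <;> rfl⟩

theorem par_comm (P Q : LPoset A) : Isom (par P Q) (par Q P) := by
  have key : ∀ x y : P.carrier ⊕ Q.carrier,
      Sum.LiftRel Q.lt P.lt (Equiv.sumComm _ _ x) (Equiv.sumComm _ _ y) ↔
        Sum.LiftRel P.lt Q.lt x y := by
    rintro (x | x) (y | y) <;> simp
  exact ⟨Equiv.sumComm _ _, key, by rintro (x | x) <;> rfl⟩

theorem empty_seq (P : LPoset A) : Isom (seq empty P) P := by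
  refine Isom.symm ⟨(Equiv.emptySum Empty _).symm, fun x y => ?_, fun _ => rfl⟩
  exact Sum.lex_inr_inr

theorem seq_empty (P : LPoset A) : Isom (seq P empty) P := by
  refine Isom.symm ⟨(Equiv.sumEmpty _ Empty).symm, fun x y => ?_, fun _ => rfl⟩
  exact Sum.lex_inl_inl

theorem empty_par (P : LPoset A) : Isom (par empty P) P := by
  refine Isom.symm ⟨(Equiv.emptySum Empty _).symm, fun x y => ?_, fun _ => rfl⟩
  exact Sum.liftRel_inr_inr

end LPoset

namespace SP

variable {A A' : Type*}

@[elab_as_elim]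
theorem induction {motive : SP A → Prop} (empty : motive empty)
    (letter : ∀ a, motive (letter a))
    (op : ∀ o p q, motive p → motive q → motive (op o p q)) (p : SP A) : motive p := by
  obtain ⟨p, hp⟩ := p
  induction hp with
  | empty => exact empty
  | single a => exact letter a
  | seq _ _ h k => exact op .seq _ _ h k
  | par _ _ h k => exact op .par _ _ h k

theorem op_assoc (o : Op) (p q r : SP A) : op o (op o p q) r = op o p (op o q r) := by
  obtain ⟨p, hp⟩ := p
  obtain ⟨q, hq⟩ := q
  obtain ⟨r, hr⟩ := r
  cases o with
  | seq =>
    refine Subtype.ext ?_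
    change (p.seq q).seq r = p.seq (q.seq r)
    clear hp hq hr
    induction p, q, r using Quotient.inductionOn₃ with
    | h P Q R => exact Pomset.mk_eq (LPoset.seq_assoc P Q R)
  | par =>
    refine Subtype.ext ?_
    change (p.par q).par r = p.par (q.par r)
    clear hp hq hr
    induction p, q, r using Quotient.inductionOn₃ with
    | h P Q R => exact Pomset.mk_eq (LPoset.par_assoc P Q R)

theorem par_comm (p q : SP A) : op .par p q = op .par q p := by
  refine Subtype.ext ?_
  change p.1.par q.1 = q.1.par p.1
  induction p.1, q.1 using Quotient.inductionOn₂ with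
  | h P Q => exact Pomset.mk_eq (LPoset.par_comm P Q)

theorem empty_op (o : Op) (p : SP A) : op o empty p = p := by
  cases o with
  | seq =>
    refine Subtype.ext ?_
    change Pomset.empty.seq p.1 = p.1
    induction p.1 using Quotient.inductionOn with
    | h P => exact Pomset.mk_eq (LPoset.empty_seq P)
  | par =>
    refine Subtype.ext ?_
    change Pomset.empty.par p.1 = p.1
    induction p.1 using Quotient.inductionOn with
    | h P => exact Pomset.mk_eq (LPoset.empty_par P)

theorem op_empty (o : Op) (p : SP A) : op o p empty = p := by
  cases o with
  | seq =>
    refine Subtype.ext ?_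
    change p.1.seq Pomset.empty = p.1
    induction p.1 using Quotient.inductionOn with
    | h P => exact Pomset.mk_eq (LPoset.seq_empty P)
  | par => rw [par_comm, empty_op]

theorem bind_empty (f : A → SP A') : bind empty f = empty :=
  Subtype.ext (Pomset.bind_empty _)

theorem bind_letter (a : A) (f : A → SP A') : bind (letter a) f = f a :=
  Subtype.ext (Pomset.bind_single a _)

theorem bind_op (o : Op) (p q : SP A) (f : A → SP A') :
    bind (op o p q) f = op o (bind p f) (bind q f) := by
  cases o with
  | seq => exact Subtype.ext (Pomset.bind_seq _ _ _)
  | par => exact Subtype.ext (Pomset.bind_par _ _ _)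

theorem bind_bind {A'' : Type*} (p : SP A) (f : A → SP A') (g : A' → SP A'') :
    (p.bind f).bind g = p.bind fun a => (f a).bind g := by
  induction p using SP.induction with
  | empty => simp only [bind_empty]
  | letter a => simp only [bind_letter]
  | op o p q hp hq => simp only [bind_op, hp, hq]

theorem bind_letter_right (p : SP A) : p.bind letter = p := by
  induction p using SP.induction with
  | empty => rw [bind_empty]
  | letter a => rw [bind_letter]
  | op o p q hp hq => rw [bind_op, hp, hq]

theorem exists_term (p : SP A) : ∃ t : Term A, t.denote = p := by
  induction p using SP.induction with
  | empty => exact ⟨.eps, rfl⟩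
  | letter a => exact ⟨.letter a, rfl⟩
  | op o p q hp hq =>
    obtain ⟨s, rfl⟩ := hp
    obtain ⟨t, rfl⟩ := hq
    exact ⟨.node o s t, rfl⟩

end SP

namespace Context

variable {A : Type*}

theorem fill_hole (w : SP A) : hole.fill w = w := SP.bind_letter _ _

theorem embed_bind (z w : SP A) :
    ((embed z).bind fun x => x.elim w SP.letter) = z := by
  rw [embed, SP.bind_bind]
  simp only [SP.bind_letter, Option.elim]
  exact SP.bind_letter_right z

theorem fill_holeLeft (o : Op) (z w : SP A) : (holeLeft o z).fill w = SP.op o w z := by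
  change SP.bind (SP.op o _ _) _ = _
  rw [SP.bind_op, SP.bind_letter, embed_bind]
  rfl

theorem fill_holeRight (o : Op) (z w : SP A) : (holeRight o z).fill w = SP.op o z w := by
  change SP.bind (SP.op o _ _) _ = _
  rw [SP.bind_op, SP.bind_letter, embed_bind]
  rfl

theorem fill_comp (c d : Context A) (w : SP A) : (c.comp d).fill w = c.fill (d.fill w) := by
  change SP.bind (SP.bind c.1 _) _ = SP.bind c.1 _
  rw [SP.bind_bind]
  congr 1
  funext x
  cases x with
  | none => rfl
  | some a => exact SP.bind_letter _ _

end Context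

/-! ## Canonical decompositions -/

namespace Term

variable {A : Type*}

/-- Every term can be freed from superfluous empty leaves without increasing its depth. -/
theorem exists_epsFree (t : Term A) : t.denote = SP.empty ∨
    ∃ s : Term A, s.EpsFree ∧ s.denote = t.denote ∧ s.depth ≤ t.depth := by
  induction t with
  | eps => exact Or.inl rfl
  | letter a => exact Or.inr ⟨.letter a, trivial, rfl, le_rfl⟩
  | node o s t hs ht =>
    rcases hs with hs | ⟨s', h1, h2, h3⟩ <;> rcases ht with ht | ⟨t', k1, k2, k3⟩
    · left
      rw [denote, hs, ht, SP.empty_op]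
    · right
      refine ⟨t', k1, ?_, by rw [depth]; omega⟩
      rw [denote, hs, SP.empty_op, k2]
    · right
      refine ⟨s', h1, ?_, by rw [depth]; omega⟩
      rw [denote, ht, SP.op_empty, h2]
    · exact Or.inr ⟨.node o s' t', ⟨h1, k1⟩, by rw [denote, denote, h2, k2],
        by rw [depth, depth]; omega⟩

/-- A term of least depth exists, and erasing its empty leaves does not increase the depth, so
minimality and the absence of `ε` are achieved together. -/
theorem exists_isCanonical (w : SP A) (hw : w ≠ SP.empty) : ∃ t : Term A, t.IsCanonical w := by
  obtain ⟨t, ht, hmin⟩ := WellFounded.has_min (measure (Term.depth (A := A))).wf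
    {t | t.denote = w} (SP.exists_term w)
  change t.denote = w at ht
  rcases exists_epsFree t with h | ⟨s, h1, h2, h3⟩
  · exact absurd (ht.symm.trans h) hw
  · exact ⟨s, h2.trans ht, fun s' hs' => h3.trans (not_lt.1 (hmin s' hs')), fun _ => h1⟩

end Term

/-- The minimal depth of a term that describes `w`. -/
noncomputable def minDepth {A : Type*} (w : SP A) : ℕ :=
  sInf (Term.depth '' {t : Term A | t.denote = w})

namespace CanonicalDecomposition

variable {A : Type*} {z z₁ z₂ : SP A} {o : Op}

theorem eq_op (h : CanonicalDecomposition z o z₁ z₂) : z = SP.op o z₁ z₂ := by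
  obtain ⟨t₁, t₂, h, rfl, rfl⟩ := h
  exact h.1.symm

/-- This is what makes the recursion of `FindEBP` end: the canonical term has minimal depth, and its
two subtrees are strictly shallower. -/
theorem minDepth_lt (h : CanonicalDecomposition z o z₁ z₂) :
    minDepth z₁ < minDepth z ∧ minDepth z₂ < minDepth z := by
  obtain ⟨t₁, t₂, h, rfl, rfl⟩ := h
  have h0 : max t₁.depth t₂.depth + 1 ≤ minDepth z := by
    refine le_csInf ⟨_, _, h.1, rfl⟩ ?_
    rintro _ ⟨s, hs, rfl⟩
    exact h.2.1 s hs
  have h1 : minDepth t₁.denote ≤ t₁.depth := Nat.sInf_le ⟨t₁, rfl, rfl⟩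
  have h2 : minDepth t₂.denote ≤ t₂.depth := Nat.sInf_le ⟨t₂, rfl, rfl⟩
  omega

theorem exists_of_ne (h0 : z ≠ SP.empty) (h1 : ∀ a, z ≠ SP.letter a) :
    ∃ o z₁ z₂, CanonicalDecomposition z o z₁ z₂ := by
  obtain ⟨t, ht⟩ := Term.exists_isCanonical z h0
  cases t with
  | eps => exact absurd ht.1.symm h0
  | letter a => exact absurd ht.1.symm (h1 a)
  | node o s t => exact ⟨o, _, _, s, t, ht, rfl, rfl⟩

end CanonicalDecomposition

/-! ## Evaluation is a function -/

namespace LPoset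

variable {A : Type*}

/-- The way in which the elements of the first factor of a composition relate to those of the
second one. -/
def OpRel (P : LPoset A) : Op → P.carrier → P.carrier → Prop
  | .seq, x, y => P.lt x y
  | .par, x, y => ¬ P.lt x y ∧ ¬ P.lt y x ∧ x ≠ y

variable {P : LPoset A}

/-- Because of this, `Sep` forces the two factors to be disjoint, and no separate hypothesis of
disjointness is needed in `EvalOn`. -/
theorem OpRel.ne {o : Op} {x y : P.carrier} (h : P.OpRel o x y) : x ≠ y := by
  cases o with
  | seq => rintro rfl; exact P.irrefl _ h
  | par => exact h.2.2

/-- Every element of `U` relates to every element of `V` as in a composition. -/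
def Sep (P : LPoset A) (o : Op) (U V : Set P.carrier) : Prop :=
  ∀ x ∈ U, ∀ y ∈ V, P.OpRel o x y

theorem Sep.mono {o : Op} {U V U' V' : Set P.carrier} (h : P.Sep o U V) (hU : U' ⊆ U)
    (hV : V' ⊆ V) : P.Sep o U' V' := fun x hx y hy => h x (hU hx) y (hV hy)

/-- A strict order has no two elements that lie below each other, and none that are both comparable
and incomparable. Only the parallel relation is symmetric, whence the exception. -/
theorem Sep.empty_of_reverse {o o' : Op} (hne : ¬ (o = .par ∧ o' = .par)) {U V : Set P.carrier}
    (h : P.Sep o U V) (k : P.Sep o' V U) : U = ∅ ∨ V = ∅ := by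
  by_contra! hc
  obtain ⟨⟨x, hx⟩, y, hy⟩ := hc
  have h := h x hx y hy
  have k := k y hy x hx
  cases o with
  | seq =>
    cases o' with
    | seq => exact P.irrefl _ (P.trans _ _ _ h k)
    | par => exact k.2.1 h
  | par =>
    cases o' with
    | seq => exact h.2.1 k
    | par => exact hne ⟨rfl, rfl⟩

theorem Sep.empty_of_ne {o o' : Op} (hne : o ≠ o') {U V : Set P.carrier}
    (h : P.Sep o U V) (k : P.Sep o' U V) : U = ∅ ∨ V = ∅ := by
  by_contra! hc
  obtain ⟨⟨x, hx⟩, y, hy⟩ := hc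
  have h := h x hx y hy
  have k := k x hx y hy
  cases o <;> cases o' <;> first | exact hne rfl | exact h.1 k | exact k.1 h

end LPoset

namespace Recognizer

variable {A M : Type*}

/-- Evaluation of the sub-posets of a fixed labelled poset. -/
inductive EvalOn (R : Recognizer A M) (P : LPoset A) : Set P.carrier → M → Prop
  | empty : EvalOn R P ∅ R.one
  | single (x : P.carrier) : EvalOn R P {x} (R.init (P.label x))
  | op (o : Op) {U V : Set P.carrier} {x y : M} : P.Sep o U V →
      EvalOn R P U x → EvalOn R P V y → EvalOn R P (U ∪ V) (R.op o x y)

variable {R : Recognizer A M} {P : LPoset A}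

theorem EvalOn.eq_one {U : Set P.carrier} {x : M} (h : R.EvalOn P U x) (hU : U = ∅) :
    x = R.one := by
  induction h with
  | empty => rfl
  | single x => exact absurd hU (Set.singleton_ne_empty x)
  | op o _ _ _ h k =>
    obtain ⟨rfl, rfl⟩ := Set.union_empty_iff.1 hU
    rw [h rfl, k rfl, R.one_op]

theorem EvalOn.eq_init {U : Set P.carrier} {x : M} (h : R.EvalOn P U x) {a : P.carrier}
    (hU : U = {a}) : x = R.init (P.label a) := by
  induction h with
  | empty => exact absurd hU.symm (Set.singleton_ne_empty a)
  | single x => rw [Set.singleton_injective hU]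
  | @op o U V x y hs h₁ h₂ h k =>
    have hsub : U ⊆ {a} := hU ▸ Set.subset_union_left
    have hsub' : V ⊆ {a} := hU ▸ Set.subset_union_right
    rcases Set.subset_singleton_iff_eq.1 hsub with rfl | rfl
    · rw [h₁.eq_one rfl, R.one_op]
      exact k (by rwa [Set.empty_union] at hU)
    · rcases Set.subset_singleton_iff_eq.1 hsub' with rfl | rfl
      · rw [h₂.eq_one rfl, R.op_one]
        exact h rfl
      · exact absurd rfl (hs a rfl a rfl).ne

/-- The value of a composition is the composition of the values of its factors. -/
theorem EvalOn.split {U : Set P.carrier} {x : M} (h : R.EvalOn P U x) :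
    ∀ (o : Op) (V W : Set P.carrier), U = V ∪ W → P.Sep o V W →
      ∃ y z, R.EvalOn P V y ∧ R.EvalOn P W z ∧ x = R.op o y z := by
  induction h with
  | empty =>
    intro o V W hU _
    obtain ⟨rfl, rfl⟩ := Set.union_empty_iff.1 hU.symm
    exact ⟨_, _, .empty, .empty, (R.one_op o _).symm⟩
  | single a =>
    intro o V W hU hs
    have hsub : V ⊆ {a} := hU ▸ Set.subset_union_left
    have hsub' : W ⊆ {a} := hU ▸ Set.subset_union_right
    rcases Set.subset_singleton_iff_eq.1 hsub with rfl | rfl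
    · rw [Set.empty_union] at hU
      subst hU
      exact ⟨_, _, .empty, .single a, (R.one_op o _).symm⟩
    · rcases Set.subset_singleton_iff_eq.1 hsub' with rfl | rfl
      · exact ⟨_, _, .single a, .empty, (R.op_one o _).symm⟩
      · exact absurd rfl (hs a rfl a rfl).ne
  | @op o' U₁ U₂ x₁ x₂ hs' h₁ h₂ ih₁ ih₂ =>
    intro o V W hU hs
    -- The two decompositions of `U` cut it into four pieces. The goal becomes the interchange law
    -- for the values `y₁`, `z₁`, `y₂`, `z₂` of these pieces.
    have hU₁ : U₁ = U₁ ∩ V ∪ U₁ ∩ W := by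
      rw [← Set.inter_union_distrib_left, ← hU]
      exact (Set.inter_eq_left.2 Set.subset_union_left).symm
    have hU₂ : U₂ = U₂ ∩ V ∪ U₂ ∩ W := by
      rw [← Set.inter_union_distrib_left, ← hU]
      exact (Set.inter_eq_left.2 Set.subset_union_right).symm
    have hV : V = U₁ ∩ V ∪ U₂ ∩ V := by
      rw [← Set.union_inter_distrib_right, hU]
      exact (Set.inter_eq_right.2 Set.subset_union_left).symm
    have hW : W = U₁ ∩ W ∪ U₂ ∩ W := by
      rw [← Set.union_inter_distrib_right, hU]
      exact (Set.inter_eq_right.2 Set.subset_union_right).symm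
    obtain ⟨y₁, z₁, hy₁, hz₁, rfl⟩ := ih₁ o _ _ hU₁
      (hs.mono Set.inter_subset_right Set.inter_subset_right)
    obtain ⟨y₂, z₂, hy₂, hz₂, rfl⟩ := ih₂ o _ _ hU₂
      (hs.mono Set.inter_subset_right Set.inter_subset_right)
    have e₁ : P.Sep o' (U₁ ∩ V) (U₂ ∩ V) := hs'.mono Set.inter_subset_left Set.inter_subset_left
    have e₂ : P.Sep o' (U₁ ∩ W) (U₂ ∩ W) := hs'.mono Set.inter_subset_left Set.inter_subset_left
    have hy : R.EvalOn P V (R.op o' y₁ y₂) := by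
      rw [hV]
      exact .op o' e₁ hy₁ hy₂
    have hz : R.EvalOn P W (R.op o' z₁ z₂) := by
      rw [hW]
      exact .op o' e₂ hz₁ hz₂
    refine ⟨_, _, hy, hz, ?_⟩
    have c₁ : P.Sep o' (U₁ ∩ V) (U₂ ∩ W) := hs'.mono Set.inter_subset_left Set.inter_subset_left
    have c₂ : P.Sep o' (U₁ ∩ W) (U₂ ∩ V) := hs'.mono Set.inter_subset_left Set.inter_subset_left
    have d₁ : P.Sep o (U₁ ∩ V) (U₂ ∩ W) := hs.mono Set.inter_subset_right Set.inter_subset_right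
    have d₂ : P.Sep o (U₂ ∩ V) (U₁ ∩ W) := hs.mono Set.inter_subset_right Set.inter_subset_right
    by_cases hpar : o = .par ∧ o' = .par
    · obtain ⟨rfl, rfl⟩ := hpar
      rw [R.assoc, R.assoc, ← R.assoc _ z₁, R.par_comm z₁ y₂, R.assoc]
    -- These two pieces stand in opposite orders in the two decompositions, so one of them is empty.
    -- For equal operators associativity then suffices; for different ones the other diagonal also
    -- loses a piece, being related in two incompatible ways.
    · have hrev : U₂ ∩ V = ∅ ∨ U₁ ∩ W = ∅ := d₂.empty_of_reverse hpar c₂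
      by_cases hoo : o = o'
      · subst hoo
        rcases hrev with he | he
        · rw [hy₂.eq_one he, R.one_op, R.op_one, R.assoc]
        · rw [hz₁.eq_one he, R.one_op, R.op_one, R.assoc]
      · rcases d₁.empty_of_ne hoo c₁ with hd | hd <;> rcases hrev with he | he
        · rw [hy₁.eq_one hd, hy₂.eq_one he]
          simp only [R.one_op]
        · rw [hy₁.eq_one hd, hz₁.eq_one he]
          simp only [R.one_op]
        · rw [hz₂.eq_one hd, hy₂.eq_one he]
          simp only [R.op_one]
        · rw [hz₂.eq_one hd, hz₁.eq_one he]
          simp only [R.op_one]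

/-- `EvalOn.split` cuts the second evaluation along the factors of the first. Working with subsets
of one fixed poset, and not with isomorphism classes, is what allows factors of different
decompositions to be intersected. -/
theorem EvalOn.unique {U : Set P.carrier} {x : M} (h : R.EvalOn P U x) :
    ∀ y, R.EvalOn P U y → x = y := by
  induction h with
  | empty => exact fun y hy => (hy.eq_one rfl).symm
  | single a => exact fun y hy => (hy.eq_init rfl).symm
  | op o hs _ _ h k =>
    intro y hy
    obtain ⟨y₁, y₂, h₁, h₂, rfl⟩ := hy.split o _ _ rfl hs
    rw [h y₁ h₁, k y₂ h₂]

/-- An evaluation of an isomorphism class is transported to a subset of `P` along an embedding. The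
embedding has to be arbitrary, since the factors of a composition occupy only a part of `P`. -/
theorem Eval.evalOn {p : SP A} {x : M} (h : R.Eval p x) :
    ∀ (Q : LPoset A), Pomset.mk Q = p.1 → ∀ f : Q.carrier → P.carrier,
      Function.Injective f → (∀ a b, P.lt (f a) (f b) ↔ Q.lt a b) →
      (∀ a, P.label (f a) = Q.label a) → R.EvalOn P (Set.range f) x := by
  induction h with
  | empty =>
    intro Q hQ f _ _ _
    obtain ⟨e, -, -⟩ := Quotient.exact hQ
    have : IsEmpty Q.carrier := e.isEmpty_congr.2 (inferInstanceAs (IsEmpty Empty))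
    rw [Set.range_eq_empty]
    exact .empty
  | letter a =>
    intro Q hQ f _ _ hl
    obtain ⟨e, -, he⟩ := Quotient.exact hQ
    have : Unique Q.carrier := Equiv.unique (β := Unit) e
    rw [Set.range_unique]
    have hd : P.label (f default) = a := (hl _).trans (he _).symm
    exact hd ▸ EvalOn.single (f default)
  | @op o p q x y _ _ hp hq =>
    intro Q hQ f hf hlt hl
    obtain ⟨⟨p⟩, hp'⟩ := p
    obtain ⟨⟨q⟩, hq'⟩ := q
    -- The argument common to both operators: only the relation between the two summands, given by
    -- `OpRel`, depends on `o`.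
    have key : ∀ (e : p.carrier ⊕ q.carrier ≃ Q.carrier),
        (∀ a b, p.lt a b ↔ Q.lt (e (.inl a)) (e (.inl b))) →
        (∀ a b, q.lt a b ↔ Q.lt (e (.inr a)) (e (.inr b))) →
        (∀ a b, Q.OpRel o (e (.inl a)) (e (.inr b))) →
        (∀ a, Q.label (e (.inl a)) = p.label a) → (∀ a, Q.label (e (.inr a)) = q.label a) →
        R.EvalOn P (Set.range f) (R.op o x y) := by
      intro e h1 h2 h3 h4 h5
      have hr : Set.range f = Set.range (fun a => f (e (.inl a))) ∪
          Set.range (fun a => f (e (.inr a))) := by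
        refine (e.surjective.range_comp f).symm.trans ?_
        exact Sum.range_eq (f ∘ e)
      rw [hr]
      refine .op o ?_ ?_ ?_
      · rintro _ ⟨a, rfl⟩ _ ⟨b, rfl⟩
        have := h3 a b
        cases o with
        | seq => exact (hlt _ _).2 this
        | par => exact ⟨fun h => this.1 ((hlt _ _).1 h), fun h => this.2.1 ((hlt _ _).1 h),
            fun h => this.2.2 (hf h)⟩
      · exact hp p rfl _ (fun a b h => Sum.inl_injective (e.injective (hf h)))
          (fun a b => (hlt _ _).trans (h1 a b).symm) fun a => (hl _).trans (h4 a)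
      · exact hq q rfl _ (fun a b h => Sum.inr_injective (e.injective (hf h)))
          (fun a b => (hlt _ _).trans (h2 a b).symm) fun a => (hl _).trans (h5 a)
    cases o with
    | seq =>
      obtain ⟨e, he, hel⟩ : LPoset.Isom (p.seq q) Q := LPoset.Isom.symm (Quotient.exact hQ)
      exact key e (fun a b => (Sum.lex_inl_inl.symm.trans (he (.inl a) (.inl b)).symm))
        (fun a b => (Sum.lex_inr_inr.symm.trans (he (.inr a) (.inr b)).symm))
        (fun a b => (he (.inl a) (.inr b)).2 (Sum.Lex.sep _ _))
        (fun a => hel (.inl a)) (fun a => hel (.inr a))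
    | par =>
      obtain ⟨e, he, hel⟩ : LPoset.Isom (p.par q) Q := LPoset.Isom.symm (Quotient.exact hQ)
      exact key e (fun a b => (Sum.liftRel_inl_inl.symm.trans (he (.inl a) (.inl b)).symm))
        (fun a b => (Sum.liftRel_inr_inr.symm.trans (he (.inr a) (.inr b)).symm))
        (fun a b => ⟨fun h => Sum.not_liftRel_inl_inr ((he (.inl a) (.inr b)).1 h),
          fun h => Sum.not_liftRel_inr_inl ((he (.inr b) (.inl a)).1 h),
          fun h => Sum.inl_ne_inr (e.injective h)⟩)
        (fun a => hel (.inl a)) (fun a => hel (.inr a))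

theorem Eval.unique {p : SP A} {x y : M} (h : R.Eval p x) (k : R.Eval p y) : x = y := by
  have hp : Pomset.mk (Quotient.out p.1) = p.1 := Quotient.out_eq p.1
  exact (h.evalOn _ hp id Function.injective_id (fun _ _ => Iff.rfl) fun _ => rfl).unique _
    (k.evalOn _ hp id Function.injective_id (fun _ _ => Iff.rfl) fun _ => rfl)

theorem exists_eval (R : Recognizer A M) (p : SP A) : ∃ x, R.Eval p x := by
  induction p using SP.induction with
  | empty => exact ⟨_, .empty⟩
  | letter a => exact ⟨_, .letter a⟩
  | op o p q hp hq =>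
    obtain ⟨x, hx⟩ := hp
    obtain ⟨y, hy⟩ := hq
    exact ⟨_, .op o hx hy⟩

theorem mem_language_iff {p : SP A} {x : M} (h : R.Eval p x) : p ∈ R.language ↔ x ∈ R.final :=
  ⟨fun ⟨_, hy, hp⟩ => h.unique hp ▸ hy, fun hx => ⟨x, hx, h⟩⟩

/-- Substitution commutes with both operations, so equality of values on letters propagates to all
pomsets. It is applied to the two fillings of a context, which differ only at the placeholder. -/
theorem exists_eval_bind {A' : Type*} {f g : A' → SP A}
    (h : ∀ a, ∃ x, R.Eval (f a) x ∧ R.Eval (g a) x) (p : SP A') :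
    ∃ x, R.Eval (p.bind f) x ∧ R.Eval (p.bind g) x := by
  induction p using SP.induction with
  | empty => simp only [SP.bind_empty]; exact ⟨_, .empty, .empty⟩
  | letter a => simp only [SP.bind_letter]; exact h a
  | op o p q hp hq =>
    obtain ⟨x, hx, hx'⟩ := hp
    obtain ⟨y, hy, hy'⟩ := hq
    simp only [SP.bind_op]
    exact ⟨_, .op o hx hy, .op o hx' hy'⟩

/-- Pomsets with the same value are equivalent in every context. -/
theorem fill_mem_language_iff {u v : SP A} {x : M} (hu : R.Eval u x) (hv : R.Eval v x)
    (c : Context A) : c.fill u ∈ R.language ↔ c.fill v ∈ R.language := by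
  obtain ⟨y, h, k⟩ := exists_eval_bind (R := R) (f := fun a : Option A => a.elim u SP.letter)
    (g := fun a => a.elim v SP.letter) (fun a => by
      cases a with
      | none => exact ⟨x, hu, hv⟩
      | some a => exact ⟨_, .letter a, .letter a⟩) c.1
  exact (mem_language_iff h).trans (mem_language_iff k).symm

end Recognizer

/-- A recognizable language has a finite invariant that refines contextual equivalence. -/
theorem IsRecognizable.exists_invariant {A : Type*} {L : Set (SP A)} (hL : IsRecognizable L) :
    ∃ (M : Type) (_ : Finite M) (κ : SP A → M),
      ∀ u v, κ u = κ v → ∀ c : Context A, c.fill u ∈ L ↔ c.fill v ∈ L := by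
  obtain ⟨M, R, rfl⟩ := hL
  choose κ hκ using R.exists_eval
  exact ⟨M, R.finite, κ, fun u v h c => R.fill_mem_language_iff (hκ u) (h ▸ hκ v) c⟩

/-! ## Discrimination trees -/

namespace DTree

variable {A : Type*} {L : Set (SP A)} {T l r : DTree A} {B B' : Component A} {c : Context A}
  {w u v : SP A}

theorem mem_pack_leaf {o : Option (Component A)} : B ∈ (leaf o).pack ↔ o = some B := by
  cases o with
  | none => simp [pack]
  | some B' => simp [pack, eq_comm]

theorem mem_pack_node : B ∈ (node c l r).pack ↔ B ∈ l.pack ∨ B ∈ r.pack := by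
  simp [pack]

/-- The members of the components are sifted into the leaves labelled by their components, and
components are nonempty. -/
def WF (L : Set (SP A)) : DTree A → Prop
  | leaf B => ∀ B', B = some B' → B'.Nonempty
  | node c l r => (∀ B ∈ l.pack, ∀ w ∈ B, c.fill w ∉ L) ∧ (∀ B ∈ r.pack, ∀ w ∈ B, c.fill w ∈ L) ∧
      l.WF L ∧ r.WF L

/-- `w` belongs to some component. -/
def Covered (T : DTree A) (w : SP A) : Prop := ∃ B ∈ T.pack, w ∈ B

theorem covered_node : (node c l r).Covered w ↔ l.Covered w ∨ r.Covered w := by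
  simp only [Covered, mem_pack_node, or_and_right, exists_or]

theorem WF.sift_eq (h : T.WF L) (hB : B ∈ T.pack) (hw : w ∈ B) : T.sift L w = some B := by
  induction T with
  | leaf o => exact mem_pack_leaf.1 hB
  | node c l r hl hr =>
    rw [sift]
    rcases mem_pack_node.1 hB with hB | hB
    · rw [if_neg (h.1 B hB w hw)]
      exact hl h.2.2.1 hB
    · rw [if_pos (h.2.1 B hB w hw)]
      exact hr h.2.2.2 hB

/-- Sifting is a function, and both components label the leaf into which `w` is sifted. -/
theorem WF.eq_of_mem (h : T.WF L) (hB : B ∈ T.pack) (hB' : B' ∈ T.pack) (hw : w ∈ B)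
    (hw' : w ∈ B') : B = B' :=
  Option.some_injective _ ((h.sift_eq hB hw).symm.trans (h.sift_eq hB' hw'))

theorem WF.mem_of_sift (h : T.WF L) (hc : T.Covered w) (hs : T.sift L w = some B) : w ∈ B := by
  obtain ⟨B', hB', hw⟩ := hc
  rw [h.sift_eq hB' hw] at hs
  exact Option.some_injective _ hs ▸ hw

theorem sift_congr (h : ∀ c ∈ T.contexts, c.fill u ∈ L ↔ c.fill v ∈ L) :
    T.sift L u = T.sift L v := by
  induction T with
  | leaf o => rfl
  | node c l r hl hr =>
    rw [sift, sift, hl fun d hd => h d (Or.inr (Or.inl hd)),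
      hr fun d hd => h d (Or.inr (Or.inr hd))]
    have hc := h c (Or.inl rfl)
    by_cases hu : c.fill u ∈ L
    · rw [if_pos hu, if_pos (hc.1 hu)]
    · rw [if_neg hu, if_neg fun hv => hu (hc.2 hv)]

/-! ### Insertion of a pomset into a discrimination tree -/

theorem insert_node_of_mem (h : c.fill w ∈ L) :
    (node c l r).insert L w = node c l (r.insert L w) := by
  rw [insert, if_pos h]

theorem insert_node_of_notMem (h : c.fill w ∉ L) :
    (node c l r).insert L w = node c (l.insert L w) r := by
  rw [insert, if_neg h]

open Classical in
-- The enlarged component is described by its members, which keeps later uses independent of the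
-- choice of decidable equality.
theorem mem_pack_insert (h : B ∈ (T.insert L w).pack) : B ∈ T.pack ∨
    (∃ B₀ ∈ T.pack, T.sift L w = some B₀ ∧ ∀ x, x ∈ B ↔ x = w ∨ x ∈ B₀) ∨
    T.sift L w = none ∧ B = {w} := by
  induction T with
  | leaf o =>
    cases o with
    | none =>
      refine Or.inr (Or.inr ⟨rfl, ?_⟩)
      exact (Option.some_injective _ (mem_pack_leaf.1 h)).symm
    | some B₀ =>
      refine Or.inr (Or.inl ⟨B₀, mem_pack_leaf.2 rfl, rfl, fun x => ?_⟩)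
      rw [← Option.some_injective _ (mem_pack_leaf.1 h), Finset.mem_insert]
  | node c l r hl hr =>
    rw [sift, mem_pack_node]
    by_cases hc : c.fill w ∈ L
    · rw [insert_node_of_mem hc, mem_pack_node] at h
      rw [if_pos hc]
      rcases h with h | h
      · exact Or.inl (Or.inl h)
      · rcases hr h with h | ⟨B₀, hB₀, h⟩ | h
        · exact Or.inl (Or.inr h)
        · exact Or.inr (Or.inl ⟨B₀, mem_pack_node.2 (Or.inr hB₀), h⟩)
        · exact Or.inr (Or.inr h)
    · rw [insert_node_of_notMem hc, mem_pack_node] at h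
      rw [if_neg hc]
      rcases h with h | h
      · rcases hl h with h | ⟨B₀, hB₀, h⟩ | h
        · exact Or.inl (Or.inl h)
        · exact Or.inr (Or.inl ⟨B₀, mem_pack_node.2 (Or.inl hB₀), h⟩)
        · exact Or.inr (Or.inr h)
      · exact Or.inl (Or.inr h)

theorem covered_of_covered_insert (h : (T.insert L w).Covered u) : u = w ∨ T.Covered u := by
  obtain ⟨B, hB, hu⟩ := h
  rcases mem_pack_insert hB with hB | ⟨B₀, hB₀, -, h⟩ | ⟨-, rfl⟩
  · exact Or.inr ⟨B, hB, hu⟩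
  · exact ((h u).1 hu).imp_right fun hu => ⟨B₀, hB₀, hu⟩
  · exact Or.inl (Finset.mem_singleton.1 hu)

open Classical in
theorem exists_subset_pack_insert (L : Set (SP A)) (w : SP A) (h : B ∈ T.pack) :
    ∃ B' ∈ (T.insert L w).pack, B ⊆ B' := by
  induction T with
  | leaf o =>
    obtain rfl := mem_pack_leaf.1 h
    exact ⟨_, mem_pack_leaf.2 rfl, Finset.subset_insert _ _⟩
  | node c l r hl hr =>
    by_cases hc : c.fill w ∈ L
    · rw [insert_node_of_mem hc]
      rcases mem_pack_node.1 h with h | h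
      · exact ⟨B, mem_pack_node.2 (Or.inl h), subset_rfl⟩
      · obtain ⟨B', hB', hs⟩ := hr h
        exact ⟨B', mem_pack_node.2 (Or.inr hB'), hs⟩
    · rw [insert_node_of_notMem hc]
      rcases mem_pack_node.1 h with h | h
      · obtain ⟨B', hB', hs⟩ := hl h
        exact ⟨B', mem_pack_node.2 (Or.inl hB'), hs⟩
      · exact ⟨B, mem_pack_node.2 (Or.inr h), subset_rfl⟩

theorem Covered.insert (h : T.Covered u) : (T.insert L w).Covered u := by
  obtain ⟨B, hB, hu⟩ := h
  obtain ⟨B', hB', hs⟩ := exists_subset_pack_insert L w hB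
  exact ⟨B', hB', hs hu⟩

open Classical in
theorem covered_insert_self (L : Set (SP A)) (w : SP A) (T : DTree A) :
    (T.insert L w).Covered w := by
  induction T with
  | leaf o =>
    cases o with
    | none => exact ⟨_, mem_pack_leaf.2 rfl, Finset.mem_singleton_self _⟩
    | some B => exact ⟨_, mem_pack_leaf.2 rfl, Finset.mem_insert_self _ _⟩
  | node c l r hl hr =>
    by_cases hc : c.fill w ∈ L
    · rw [insert_node_of_mem hc]
      exact covered_node.2 (Or.inr hr)
    · rw [insert_node_of_notMem hc]
      exact covered_node.2 (Or.inl hl)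

open Classical in
theorem WF.insert (h : T.WF L) (w : SP A) : (T.insert L w).WF L := by
  induction T with
  | leaf o =>
    cases o with
    | none =>
      rintro B ⟨⟩
      exact Finset.singleton_nonempty _
    | some B =>
      rintro B ⟨⟩
      exact Finset.insert_nonempty _ _
  | node c l r hl hr =>
    by_cases hc : c.fill w ∈ L
    · rw [insert_node_of_mem hc]
      refine ⟨h.1, fun B hB x hx => ?_, h.2.2.1, hr h.2.2.2⟩
      rcases covered_of_covered_insert ⟨B, hB, hx⟩ with rfl | ⟨B', hB', hx⟩
      · exact hc
      · exact h.2.1 B' hB' x hx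
    · rw [insert_node_of_notMem hc]
      refine ⟨fun B hB x hx => ?_, h.2.1, hl h.2.2.1, h.2.2.2⟩
      rcases covered_of_covered_insert ⟨B, hB, hx⟩ with rfl | ⟨B', hB', hx⟩
      · exact hc
      · exact h.1 B' hB' x hx

/-! ### Splitting of a component -/

theorem mem_pack_refine {B₀ B₁ : Component A} (h : B' ∈ (T.refine B c B₀ B₁).pack) :
    B' ∈ T.pack ∧ B' ≠ B ∨ B ∈ T.pack ∧ (B' = B₀ ∨ B' = B₁) := by
  induction T with
  | leaf o =>
    rw [refine] at h
    split_ifs at h with ho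
    · refine Or.inr ⟨mem_pack_leaf.2 ho, ?_⟩
      rw [mem_pack_node, mem_pack_leaf, mem_pack_leaf] at h
      exact h.imp (fun h => (Option.some_injective _ h).symm)
        fun h => (Option.some_injective _ h).symm
    · refine Or.inl ⟨h, ?_⟩
      rintro rfl
      exact ho (mem_pack_leaf.1 h)
  | node d l r hl hr =>
    rw [refine, mem_pack_node] at h
    rw [mem_pack_node, mem_pack_node]
    rcases h with h | h
    · exact (hl h).imp (fun h => ⟨Or.inl h.1, h.2⟩) fun h => ⟨Or.inl h.1, h.2⟩
    · exact (hr h).imp (fun h => ⟨Or.inr h.1, h.2⟩) fun h => ⟨Or.inr h.1, h.2⟩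

theorem mem_pack_refine_of_ne {B₀ B₁ : Component A} (h : B' ∈ T.pack) (hne : B' ≠ B) :
    B' ∈ (T.refine B c B₀ B₁).pack := by
  induction T with
  | leaf o =>
    obtain rfl := mem_pack_leaf.1 h
    rw [refine, if_neg fun h => hne (Option.some_injective _ h)]
    exact h
  | node d l r hl hr => exact mem_pack_node.2 ((mem_pack_node.1 h).imp hl hr)

theorem mem_pack_refine_parts {B₀ B₁ : Component A} (h : B ∈ T.pack) :
    B₀ ∈ (T.refine B c B₀ B₁).pack ∧ B₁ ∈ (T.refine B c B₀ B₁).pack := by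
  induction T with
  | leaf o =>
    obtain rfl := mem_pack_leaf.1 h
    rw [refine, if_pos rfl, mem_pack_node, mem_pack_node]
    exact ⟨Or.inl (mem_pack_leaf.2 rfl), Or.inr (mem_pack_leaf.2 rfl)⟩
  | node d l r hl hr =>
    rw [refine, mem_pack_node, mem_pack_node]
    rcases mem_pack_node.1 h with h | h
    · exact ⟨Or.inl (hl h).1, Or.inl (hl h).2⟩
    · exact ⟨Or.inr (hr h).1, Or.inr (hr h).2⟩

open Classical in
theorem mem_part₀ : w ∈ Store.part₀ L B c ↔ w ∈ B ∧ c.fill w ∉ L := by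
  rw [Store.part₀, Finset.mem_filter]

open Classical in
theorem mem_part₁ : w ∈ Store.part₁ L B c ↔ w ∈ B ∧ c.fill w ∈ L := by
  rw [Store.part₁, Finset.mem_filter]

/-- The tree after splitting the component `B` by means of the context `c`. -/
noncomputable def split (L : Set (SP A)) (T : DTree A) (B : Component A) (c : Context A) :
    DTree A :=
  T.refine B c (Store.part₀ L B c) (Store.part₁ L B c)

theorem covered_of_covered_split (h : (T.split L B c).Covered w) : T.Covered w := by
  obtain ⟨B', hB', hw⟩ := h
  rcases mem_pack_refine hB' with h | ⟨h, rfl | rfl⟩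
  · exact ⟨B', h.1, hw⟩
  · exact ⟨B, h, (mem_part₀.1 hw).1⟩
  · exact ⟨B, h, (mem_part₁.1 hw).1⟩

theorem Covered.split (h : T.Covered w) (B : Component A) (c : Context A) :
    (T.split L B c).Covered w := by
  obtain ⟨B', hB', hw⟩ := h
  by_cases hne : B' = B
  · subst hne
    by_cases hc : c.fill w ∈ L
    · exact ⟨_, (mem_pack_refine_parts hB').2, mem_part₁.2 ⟨hw, hc⟩⟩
    · exact ⟨_, (mem_pack_refine_parts hB').1, mem_part₀.2 ⟨hw, hc⟩⟩
  · exact ⟨B', mem_pack_refine_of_ne hB' hne, hw⟩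

/-- The new node separates its two leaves by the choice of the parts, and below the old nodes no new
pomset appears. Both parts must be nonempty because the counting of leaves relies on nonempty
components. -/
theorem WF.split (h : T.WF L) (h₀ : (Store.part₀ L B c).Nonempty)
    (h₁ : (Store.part₁ L B c).Nonempty) : (T.split L B c).WF L := by
  induction T with
  | leaf o =>
    rw [DTree.split, refine]
    split_ifs with ho
    · refine ⟨fun B' hB' x hx => ?_, fun B' hB' x hx => ?_, ?_, ?_⟩
      · rw [← Option.some_injective _ (mem_pack_leaf.1 hB')] at hx
        exact (mem_part₀.1 hx).2
      · rw [← Option.some_injective _ (mem_pack_leaf.1 hB')] at hx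
        exact (mem_part₁.1 hx).2
      · rintro _ ⟨⟩
        exact h₀
      · rintro _ ⟨⟩
        exact h₁
    · exact h
  | node d l r hl hr =>
    refine ⟨fun B' hB' x hx => ?_, fun B' hB' x hx => ?_, hl h.2.2.1, hr h.2.2.2⟩
    · obtain ⟨B₁, hB₁, hx⟩ := covered_of_covered_split ⟨B', hB', hx⟩
      exact h.1 B₁ hB₁ x hx
    · obtain ⟨B₁, hB₁, hx⟩ := covered_of_covered_split ⟨B', hB', hx⟩
      exact h.2.1 B₁ hB₁ x hx

/-- The root of the tree is labelled by the trivial context. -/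
def HoleRooted (T : DTree A) : Prop := ∃ l r, T = node Context.hole l r

theorem HoleRooted.insert (h : T.HoleRooted) (L : Set (SP A)) (w : SP A) :
    (T.insert L w).HoleRooted := by
  obtain ⟨l, r, rfl⟩ := h
  by_cases hc : Context.hole.fill w ∈ L
  · exact ⟨_, _, insert_node_of_mem hc⟩
  · exact ⟨_, _, insert_node_of_notMem hc⟩

theorem HoleRooted.split (h : T.HoleRooted) (L : Set (SP A)) (B : Component A) (c : Context A) :
    (T.split L B c).HoleRooted := by
  obtain ⟨l, r, rfl⟩ := h
  exact ⟨_, _, rfl⟩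

/-- The root tests membership in `L` itself. Hence acceptance is a property of the component and not
of the chosen member. -/
theorem HoleRooted.mem_iff (h : T.HoleRooted) (hT : T.WF L) (hB : B ∈ T.pack) (hu : u ∈ B)
    (hv : v ∈ B) : u ∈ L ↔ v ∈ L := by
  obtain ⟨l, r, rfl⟩ := h
  rcases mem_pack_node.1 hB with hB | hB
  · have h1 := hT.1 B hB u hu
    have h2 := hT.1 B hB v hv
    rw [Context.fill_hole] at h1 h2
    exact iff_of_false h1 h2
  · have h1 := hT.2.1 B hB u hu
    have h2 := hT.2.1 B hB v hv
    rw [Context.fill_hole] at h1 h2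
    exact iff_of_true h1 h2

/-- The number of labelled leaves. -/
def leafCount : DTree A → ℕ
  | leaf none => 0
  | leaf (some _) => 1
  | node _ l r => l.leafCount + r.leafCount

theorem leafCount_le_insert (L : Set (SP A)) (w : SP A) (T : DTree A) :
    T.leafCount ≤ (T.insert L w).leafCount := by
  induction T with
  | leaf o => cases o <;> simp [insert, leafCount]
  | node c l r hl hr =>
    by_cases hc : c.fill w ∈ L
    · rw [insert_node_of_mem hc, leafCount, leafCount]
      omega
    · rw [insert_node_of_notMem hc, leafCount, leafCount]
      omega

theorem leafCount_lt_insert (h : T.sift L w = none) :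
    T.leafCount < (T.insert L w).leafCount := by
  induction T with
  | leaf o =>
    cases o with
    | none => exact Nat.zero_lt_one
    | some B => cases h
  | node c l r hl hr =>
    rw [sift] at h
    split_ifs at h with hc
    · have := hr h
      rw [insert_node_of_mem hc, leafCount, leafCount]
      omega
    · have := hl h
      rw [insert_node_of_notMem hc, leafCount, leafCount]
      omega

theorem leafCount_le_refine (B : Component A) (c : Context A) (B₀ B₁ : Component A)
    (T : DTree A) : T.leafCount ≤ (T.refine B c B₀ B₁).leafCount := by
  induction T with
  | leaf o =>
    rw [refine]
    split_ifs with ho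
    · subst ho
      simp [leafCount]
    · exact le_rfl
  | node d l r hl hr =>
    rw [refine, leafCount, leafCount]
    omega

theorem leafCount_lt_refine {B₀ B₁ : Component A} (h : B ∈ T.pack) :
    T.leafCount < (T.refine B c B₀ B₁).leafCount := by
  induction T with
  | leaf o =>
    obtain rfl := mem_pack_leaf.1 h
    rw [refine, if_pos rfl]
    simp [leafCount]
  | node d l r hl hr =>
    have h1 := leafCount_le_refine B c B₀ B₁ l
    have h2 := leafCount_le_refine B c B₀ B₁ r
    rw [refine, leafCount, leafCount]
    rcases mem_pack_node.1 h with h | h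
    · have := hl h
      omega
    · have := hr h
      omega

/-- There are at most as many components as there are values of an invariant that refines
contextual equivalence. -/
theorem WF.leafCount_le {M : Type*} [Finite M] {κ : SP A → M}
    (hκ : ∀ u v, κ u = κ v → ∀ c : Context A, c.fill u ∈ L ↔ c.fill v ∈ L) (h : T.WF L) :
    T.leafCount ≤ Nat.card M := by
  -- Only the values of `κ` taken on covered pomsets are counted, so that the counts of the two
  -- subtrees can be added.
  suffices T.leafCount ≤ {m | ∃ w, T.Covered w ∧ κ w = m}.ncard from
    this.trans (Set.ncard_le_card _)
  induction T with
  | leaf o =>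
    cases o with
    | none => exact Nat.zero_le _
    | some B =>
      obtain ⟨w, hw⟩ := h B rfl
      exact Nat.one_le_iff_ne_zero.2 (Set.ncard_ne_zero_of_mem (a := κ w)
        ⟨w, ⟨B, mem_pack_leaf.2 rfl, hw⟩, rfl⟩)
  | node c l r hl hr =>
    have hu : {m | ∃ w, (node c l r).Covered w ∧ κ w = m} =
        {m | ∃ w, l.Covered w ∧ κ w = m} ∪ {m | ∃ w, r.Covered w ∧ κ w = m} := by
      ext m
      simp only [covered_node, Set.mem_union, Set.mem_ofPred_eq, or_and_right, exists_or]
    -- A common value would make `c` answer alike on the left and on the right of the node labelled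
    -- `c`.
    have hd : Disjoint {m | ∃ w, l.Covered w ∧ κ w = m} {m | ∃ w, r.Covered w ∧ κ w = m} := by
      rw [Set.disjoint_left]
      rintro _ ⟨u, ⟨B, hB, hu⟩, rfl⟩ ⟨v, ⟨B', hB', hv⟩, he⟩
      exact h.1 B hB u hu ((hκ v u he c).1 (h.2.1 B' hB' v hv))
    rw [hu, Set.ncard_union_eq hd]
    exact Nat.add_le_add (hl h.2.2.1) (hr h.2.2.2)

end DTree

open Control

variable {A : Type*}

/-! ## Invariants of the access sequences and components -/

/-- Pomsets that are built step by step from access sequences, without leaving `S` on the way. -/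
inductive Reach (S : Finset (SP A)) : SP A → Prop
  | empty : Reach S SP.empty
  | letter (a : A) : Reach S (SP.letter a)
  | op (o : Op) {u v : SP A} : u ∈ S → v ∈ S → Reach S u → Reach S v → Reach S (SP.op o u v)

theorem Reach.mono {S S' : Finset (SP A)} (hS : S ⊆ S') {x : SP A} (h : Reach S x) :
    Reach S' x := by
  induction h with
  | empty => exact .empty
  | letter a => exact .letter a
  | op o hu hv _ _ h k => exact .op o (hS hu) (hS hv) h k

/-- The pomsets that must belong to components: the access sequences, the letters and the
compositions of access sequences. -/
def Target (S : Finset (SP A)) (x : SP A) : Prop :=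
  x ∈ S ∨ (∃ a, x = SP.letter a) ∨ ∃ o, ∃ u ∈ S, ∃ v ∈ S, x = SP.op o u v

/-- Admissible items of the worklist that `Expand` and `Refine` process. -/
def ItemOK (S : Finset (SP A)) (T : DTree A) : Control A → Prop
  | expand p => Reach S p
  | expandLoop todo => ∀ x ∈ todo, Reach S x
  -- `B` records the component at the time of the split, which may have grown since. As `B` is
  -- nonempty and components are disjoint, it still determines the present component `B'`.
  | ensureAccess B => B.Nonempty ∧ ∃ B' ∈ T.pack, B ⊆ B'
  | _ => False

/-- The invariant of the learner while the worklist `W` is being processed. -/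
structure WorkInv (L : Set (SP A)) (S : Finset (SP A)) (T : DTree A) (W : List (Control A)) :
    Prop where
  wf : T.WF L
  root : T.HoleRooted
  empty_mem : SP.empty ∈ S
  reach : ∀ s ∈ S, Reach S s
  reach_of_covered : ∀ x, T.Covered x → Reach S x
  closed : ∀ x, Target S x → T.Covered x ∨ ∃ todo, expandLoop todo ∈ W ∧ x ∈ todo
  access : ∀ B ∈ T.pack, (∃ s ∈ S, s ∈ B) ∨ (∃ p ∈ B, expand p ∈ W) ∨
    ∃ B₀ ⊆ B, ensureAccess B₀ ∈ W
  items : ∀ i ∈ W, ItemOK S T i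

theorem mem_addAccess {st : Store A} {w x : SP A} :
    x ∈ (st.addAccess w).S ↔ x = w ∨ x ∈ st.S := by
  classical
  simp only [Store.addAccess]
  exact Finset.mem_insert

theorem mem_compositions {st : Store A} {w x : SP A} :
    x ∈ st.compositions w ↔ ∃ o, ∃ p ∈ st.S, x = SP.op o w p ∨ x = SP.op o p w := by
  classical
  simp only [Store.compositions, Finset.mem_union, Finset.mem_image]
  constructor
  · rintro ((⟨p, hp, rfl⟩ | ⟨p, hp, rfl⟩) | ⟨p, hp, rfl⟩ | ⟨p, hp, rfl⟩)
    · exact ⟨.seq, p, hp, Or.inl rfl⟩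
    · exact ⟨.seq, p, hp, Or.inr rfl⟩
    · exact ⟨.par, p, hp, Or.inl rfl⟩
    · exact ⟨.par, p, hp, Or.inr rfl⟩
  · rintro ⟨o, p, hp, rfl | rfl⟩
    · cases o with
      | seq => exact Or.inl (Or.inl ⟨p, hp, rfl⟩)
      | par => exact Or.inr (Or.inl ⟨p, hp, rfl⟩)
    · cases o with
      | seq => exact Or.inl (Or.inr ⟨p, hp, rfl⟩)
      | par => exact Or.inr (Or.inr ⟨p, hp, rfl⟩)

theorem mem_letters [Fintype A] {x : SP A} : x ∈ letters A ↔ ∃ a, x = SP.letter a := by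
  classical
  simp only [letters, Finset.mem_image, Finset.mem_univ, true_and, eq_comm]

/-- The worklist that a call of `Expand(w)` creates. -/
noncomputable def expandItems [Fintype A] (st : Store A) (w : SP A) : List (Control A) :=
  [expandLoop {w}, expandLoop ((st.addAccess w).compositions w), expandLoop (letters A)]

/-- The only new obligations are `w` itself and its compositions with access sequences, `w ∘ w`
included because `compositions` is taken after `w` has joined `S`. -/
theorem Target.mem_expandItems [Fintype A] {st : Store A} {w x : SP A}
    (h : Target (st.addAccess w).S x) :
    Target st.S x ∨ ∃ todo, expandLoop todo ∈ expandItems st w ∧ x ∈ todo := by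
  rcases h with h | h | ⟨o, u, hu, v, hv, rfl⟩
  · rcases mem_addAccess.1 h with rfl | h
    · exact Or.inr ⟨{x}, by simp [expandItems], Finset.mem_singleton_self x⟩
    · exact Or.inl (Or.inl h)
  · exact Or.inl (Or.inr (Or.inl h))
  · have hmem : expandLoop ((st.addAccess w).compositions w) ∈ expandItems st w := by
      simp [expandItems]
    rcases mem_addAccess.1 hu with rfl | hu'
    · exact Or.inr ⟨_, hmem, mem_compositions.2 ⟨o, v, hv, Or.inl rfl⟩⟩
    · rcases mem_addAccess.1 hv with rfl | hv'
      · exact Or.inr ⟨_, hmem, mem_compositions.2 ⟨o, u, hu, Or.inr rfl⟩⟩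
      · exact Or.inl (Or.inr (Or.inr ⟨o, u, hu', v, hv', rfl⟩))

theorem itemOK_expandItems [Fintype A] {st : Store A} {w : SP A} {T : DTree A}
    (hw : Reach (st.addAccess w).S w) (h : ∀ s ∈ st.S, Reach (st.addAccess w).S s) :
    ∀ i ∈ expandItems st w, ItemOK (st.addAccess w).S T i := by
  have h' : ∀ s ∈ (st.addAccess w).S, Reach (st.addAccess w).S s := fun s hs =>
    (mem_addAccess.1 hs).elim (fun e => e ▸ hw) (h s)
  have hmem : w ∈ (st.addAccess w).S := mem_addAccess.2 (Or.inl rfl)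
  intro i hi
  simp only [expandItems, List.mem_cons, List.not_mem_nil, or_false] at hi
  rcases hi with rfl | rfl | rfl
  · intro x hx
    rwa [Finset.mem_singleton.1 hx]
  · intro x hx
    obtain ⟨o, p, hp, rfl | rfl⟩ := mem_compositions.1 hx
    · exact .op o hmem hp hw (h' p hp)
    · exact .op o hp hmem (h' p hp) hw
  · intro x hx
    obtain ⟨a, rfl⟩ := mem_letters.1 hx
    exact .letter a

namespace WorkInv

variable {L : Set (SP A)} {S : Finset (SP A)} {T : DTree A} {W : List (Control A)}
  {st : Store A} {p : SP A} {todo todo' : Finset (SP A)} {B B' : Component A} {c : Context A}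

/-- The state after the first call of `Expand`. -/
theorem initial [Fintype A] (L : Set (SP A)) {st : Store A} (hS : st.S = ∅)
    (hT : st.tree = DTree.initial) :
    WorkInv L (st.addAccess SP.empty).S st.tree (expandItems st SP.empty) := by
  have hc : ∀ B : Component A, B ∉ (DTree.initial : DTree A).pack := by
    intro B hB
    rcases DTree.mem_pack_node.1 hB with h | h <;> cases DTree.mem_pack_leaf.1 h
  refine ⟨?_, ?_, mem_addAccess.2 (Or.inl rfl), ?_, ?_, ?_, ?_, ?_⟩
  · rw [hT]
    refine ⟨?_, ?_, ?_, ?_⟩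
    · exact fun B hB => by cases DTree.mem_pack_leaf.1 hB
    · exact fun B hB => by cases DTree.mem_pack_leaf.1 hB
    · exact fun B hB => by cases hB
    · exact fun B hB => by cases hB
  · exact ⟨_, _, hT⟩
  · intro s hs
    rcases mem_addAccess.1 hs with rfl | hs
    · exact .empty
    · simp [hS] at hs
  · rintro x ⟨B, hB, -⟩
    rw [hT] at hB
    exact (hc B hB).elim
  · intro x hx
    rcases hx.mem_expandItems with (h | ⟨a, rfl⟩ | ⟨o, u, hu, -⟩) | h
    · simp [hS] at h
    · exact Or.inr ⟨letters A, by simp [expandItems], mem_letters.2 ⟨a, rfl⟩⟩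
    · simp [hS] at hu
    · exact Or.inr h
  · intro B hB
    rw [hT] at hB
    exact (hc B hB).elim
  · exact itemOK_expandItems .empty fun s hs => by simp [hS] at hs

theorem expand [Fintype A] (h : WorkInv L st.S st.tree (.expand p :: W)) :
    WorkInv L (st.addAccess p).S (st.addAccess p).tree (expandItems st p ++ W) := by
  have hS : st.S ⊆ (st.addAccess p).S := fun x hx => mem_addAccess.2 (Or.inr hx)
  have hp : Reach (st.addAccess p).S p := Reach.mono hS (h.items _ List.mem_cons_self)
  have hR : ∀ s ∈ st.S, Reach (st.addAccess p).S s := fun s hs => (h.reach s hs).mono hS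
  refine ⟨h.wf, h.root, hS h.empty_mem, ?_, fun x hx => (h.reach_of_covered x hx).mono hS,
    ?_, ?_, ?_⟩
  · intro s hs
    rcases mem_addAccess.1 hs with rfl | hs
    · exact hp
    · exact hR s hs
  · intro x hx
    rcases hx.mem_expandItems with hx | ⟨todo, h1, h2⟩
    · refine (h.closed x hx).imp_right ?_
      rintro ⟨todo, h1, h2⟩
      refine ⟨todo, List.mem_append_right _ ?_, h2⟩
      simpa using h1
    · exact Or.inr ⟨todo, List.mem_append_left _ h1, h2⟩
  · intro B hB
    rcases h.access B hB with ⟨s, hs, hsB⟩ | ⟨q, hq, h1⟩ | ⟨B₀, hs, h1⟩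
    · exact Or.inl ⟨s, hS hs, hsB⟩
    · rcases List.mem_cons.1 h1 with h1 | h1
      -- The pending expansion of `p` was owed to this component; now `p` is an access sequence of
      -- it.
      · cases h1
        exact Or.inl ⟨p, mem_addAccess.2 (Or.inl rfl), hq⟩
      · exact Or.inr (Or.inl ⟨q, hq, List.mem_append_right _ h1⟩)
    · refine Or.inr (Or.inr ⟨B₀, hs, List.mem_append_right _ ?_⟩)
      simpa using h1
  · intro i hi
    rcases List.mem_append.1 hi with hi | hi
    · exact itemOK_expandItems hp hR i hi
    · have := h.items i (List.mem_cons_of_mem _ hi)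
      cases i with
      | expand q => exact Reach.mono hS this
      | expandLoop todo => exact fun x hx => (this x hx).mono hS
      | ensureAccess B => exact this
      | _ => exact this

/-- Removal of the first item, once what it is responsible for has been settled. -/
theorem tail {i : Control A} (h : WorkInv L S T (i :: W))
    (h1 : ∀ todo, i = expandLoop todo → ∀ x ∈ todo, T.Covered x)
    (h2 : ∀ q, i ≠ .expand q)
    (h3 : ∀ B₀ B, i = ensureAccess B₀ → B ∈ T.pack → B₀ ⊆ B → ∃ s ∈ S, s ∈ B) :
    WorkInv L S T W := by
  refine ⟨h.wf, h.root, h.empty_mem, h.reach, h.reach_of_covered, ?_, ?_,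
    fun i hi => h.items i (List.mem_cons_of_mem _ hi)⟩
  · intro x hx
    rcases h.closed x hx with hx | ⟨todo, ht, hx⟩
    · exact Or.inl hx
    · rcases List.mem_cons.1 ht with ht | ht
      · exact Or.inl (h1 todo ht.symm x hx)
      · exact Or.inr ⟨todo, ht, hx⟩
  · intro B hB
    rcases h.access B hB with hs | ⟨q, hq, hW⟩ | ⟨B₀, hs, hW⟩
    · exact Or.inl hs
    · rcases List.mem_cons.1 hW with hW | hW
      · exact absurd hW.symm (h2 q)
      · exact Or.inr (Or.inl ⟨q, hq, hW⟩)
    · rcases List.mem_cons.1 hW with hW | hW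
      · exact Or.inl (h3 B₀ B hW.symm hB hs)
      · exact Or.inr (Or.inr ⟨B₀, hs, hW⟩)

theorem done (h : WorkInv L S T (expandLoop ∅ :: W)) : WorkInv L S T W :=
  h.tail (by rintro _ ⟨⟩ x hx; cases hx) (by rintro q ⟨⟩) (by rintro B₀ B ⟨⟩)

theorem known (h : WorkInv L S T (expandLoop todo :: W))
    (htodo : ∀ x, x ∈ todo' ↔ x ∈ todo ∧ x ≠ p) (hc : T.Covered p) :
    WorkInv L S T (expandLoop todo' :: W) := by
  refine ⟨h.wf, h.root, h.empty_mem, h.reach, h.reach_of_covered, ?_, ?_, ?_⟩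
  · intro x hx
    rcases h.closed x hx with hx | ⟨t, ht, hx⟩
    · exact Or.inl hx
    · rcases List.mem_cons.1 ht with ht | ht
      · cases ht
        by_cases hxp : x = p
        · exact Or.inl (hxp ▸ hc)
        · exact Or.inr ⟨_, List.mem_cons_self, (htodo x).2 ⟨hx, hxp⟩⟩
      · exact Or.inr ⟨t, List.mem_cons_of_mem _ ht, hx⟩
  · intro B hB
    refine (h.access B hB).imp_right (Or.imp ?_ ?_)
    · rintro ⟨q, hq, hW⟩
      exact ⟨q, hq, by simpa using hW⟩
    · rintro ⟨B₀, hs, hW⟩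
      exact ⟨B₀, hs, by simpa using hW⟩
  · intro i hi
    rcases List.mem_cons.1 hi with rfl | hi
    · exact fun x hx => h.items _ List.mem_cons_self x ((htodo x).1 hx).1
    · exact h.items i (List.mem_cons_of_mem _ hi)

/-- Insertion of `p` into the tree; a new component has to be the task of the worklist. -/
theorem insert_tree (h : WorkInv L S T W) (hp : Reach S p) :
    WorkInv L S (T.insert L p) W ∨ T.sift L p = none ∧
      WorkInv L S (T.insert L p) (.expand p :: W) := by
  have hR : ∀ x, (T.insert L p).Covered x → Reach S x := fun x hx =>
    (DTree.covered_of_covered_insert hx).elim (fun e => e ▸ hp) (h.reach_of_covered x)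
  have hI : ∀ i ∈ W, ItemOK S (T.insert L p) i := by
    intro i hi
    have := h.items i hi
    cases i with
    | ensureAccess B =>
      obtain ⟨h1, B', hB', h2⟩ := this
      obtain ⟨B'', hB'', h3⟩ := DTree.exists_subset_pack_insert L p hB'
      exact ⟨h1, B'', hB'', h2.trans h3⟩
    | _ => exact this
  have hC : ∀ x, Target S x → (T.insert L p).Covered x ∨
      ∃ todo, expandLoop todo ∈ W ∧ x ∈ todo := fun x hx =>
    (h.closed x hx).imp_left DTree.Covered.insert
  have hA : ∀ B ∈ (T.insert L p).pack, ((∃ s ∈ S, s ∈ B) ∨ (∃ p ∈ B, .expand p ∈ W) ∨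
      ∃ B₀ ⊆ B, ensureAccess B₀ ∈ W) ∨ T.sift L p = none ∧ B = {p} := by
    intro B hB
    rcases DTree.mem_pack_insert hB with hB | ⟨B', hB', -, hm⟩ | hB
    · exact Or.inl (h.access B hB)
    · have hs : B' ⊆ B := fun x hx => (hm x).2 (Or.inr hx)
      left
      rcases h.access B' hB' with ⟨s, h1, h2⟩ | ⟨q, h1, h2⟩ | ⟨B₀, h1, h2⟩
      · exact Or.inl ⟨s, h1, hs h2⟩
      · exact Or.inr (Or.inl ⟨q, hs h1, h2⟩)
      · exact Or.inr (Or.inr ⟨B₀, h1.trans hs, h2⟩)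
    · exact Or.inr hB
  cases hs : T.sift L p with
  | some B =>
    refine Or.inl ⟨h.wf.insert p, h.root.insert L p, h.empty_mem, h.reach, hR, hC, ?_, hI⟩
    intro B hB
    refine (hA B hB).resolve_right fun h => ?_
    rw [hs] at h
    cases h.1
  | none =>
    refine Or.inr ⟨rfl, h.wf.insert p, h.root.insert L p, h.empty_mem, h.reach, hR, ?_, ?_, ?_⟩
    · intro x hx
      refine (hC x hx).imp_right ?_
      rintro ⟨todo, h1, h2⟩
      exact ⟨todo, List.mem_cons_of_mem _ h1, h2⟩
    · intro B hB
      rcases hA B hB with h | ⟨-, rfl⟩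
      · refine h.imp_right (Or.imp ?_ ?_)
        · rintro ⟨q, hq, hW⟩
          exact ⟨q, hq, List.mem_cons_of_mem _ hW⟩
        · rintro ⟨B₀, hs, hW⟩
          exact ⟨B₀, hs, List.mem_cons_of_mem _ hW⟩
      · exact Or.inr (Or.inl ⟨p, Finset.mem_singleton_self p, List.mem_cons_self⟩)
    · intro i hi
      rcases List.mem_cons.1 hi with rfl | hi
      · exact hp
      · exact hI i hi

theorem insert_known (h : WorkInv L S T (expandLoop todo :: W)) (hp : p ∈ todo)
    (htodo : ∀ x, x ∈ todo' ↔ x ∈ todo ∧ x ≠ p) (hs : T.sift L p = some B) :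
    WorkInv L S (T.insert L p) (expandLoop todo' :: W) := by
  rcases h.insert_tree (h.items _ List.mem_cons_self p hp) with h' | ⟨h', -⟩
  · exact h'.known htodo (DTree.covered_insert_self L p T)
  · rw [hs] at h'
    cases h'

theorem insert_new (h : WorkInv L S T (expandLoop todo :: W)) (hp : p ∈ todo)
    (htodo : ∀ x, x ∈ todo' ↔ x ∈ todo ∧ x ≠ p) :
    WorkInv L S (T.insert L p) (.expand p :: expandLoop todo' :: W) := by
  have hR := h.items _ List.mem_cons_self p hp
  -- If no new component arises, the additional item `expand p` is harmless, since `p` is reachable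
  -- anyway.
  have key : WorkInv L S (T.insert L p) (.expand p :: expandLoop todo :: W) := by
    rcases h.insert_tree hR with h | ⟨-, h⟩
    · refine ⟨h.wf, h.root, h.empty_mem, h.reach, h.reach_of_covered, ?_, ?_, ?_⟩
      · intro x hx
        refine (h.closed x hx).imp_right ?_
        rintro ⟨todo, h1, h2⟩
        exact ⟨todo, List.mem_cons_of_mem _ h1, h2⟩
      · intro B hB
        refine (h.access B hB).imp_right (Or.imp ?_ ?_)
        · rintro ⟨q, hq, hW⟩
          exact ⟨q, hq, List.mem_cons_of_mem _ hW⟩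
        · rintro ⟨B₀, hs, hW⟩
          exact ⟨B₀, hs, List.mem_cons_of_mem _ hW⟩
      · intro i hi
        rcases List.mem_cons.1 hi with rfl | hi
        · exact hR
        · exact h.items i hi
    · exact h
  refine ⟨key.wf, key.root, key.empty_mem, key.reach, key.reach_of_covered, ?_, ?_, ?_⟩
  · intro x hx
    rcases key.closed x hx with hx | ⟨t, ht, hx⟩
    · exact Or.inl hx
    · simp only [List.mem_cons, reduceCtorEq, false_or] at ht
      rcases ht with ht | ht
      · cases ht
        by_cases hxp : x = p
        · exact Or.inl (hxp ▸ DTree.covered_insert_self L p T)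
        · exact Or.inr ⟨_, List.mem_cons_of_mem _ List.mem_cons_self, (htodo x).2 ⟨hx, hxp⟩⟩
      · exact Or.inr ⟨t, List.mem_cons_of_mem _ (List.mem_cons_of_mem _ ht), hx⟩
  · intro B hB
    refine (key.access B hB).imp_right (Or.imp ?_ ?_)
    · rintro ⟨q, hq, hW⟩
      exact ⟨q, hq, by simpa using hW⟩
    · rintro ⟨B₀, hs, hW⟩
      exact ⟨B₀, hs, by simpa using hW⟩
  · intro i hi
    simp only [List.mem_cons] at hi
    rcases hi with rfl | rfl | hi
    · exact hR
    · exact fun x hx => h.items _ List.mem_cons_self x ((htodo x).1 hx).1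
    · exact key.items i (List.mem_cons_of_mem _ (List.mem_cons_of_mem _ hi))

/-- Any component that relied on the dropped item contains the nonempty `B`, hence equals `B'`,
which already has the access sequence `p`. -/
theorem ensure_skip (h : WorkInv L S T (ensureAccess B :: W)) (hB' : B' ∈ T.pack) (hs : B ⊆ B')
    (hS : p ∈ S) (hp : p ∈ B') : WorkInv L S T W := by
  obtain ⟨⟨x, hx⟩, -⟩ := h.items _ List.mem_cons_self
  refine h.tail (by rintro _ ⟨⟩) (by rintro q ⟨⟩) ?_
  rintro B₀ B₁ ⟨⟩ hB₁ hs₁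
  obtain rfl := h.wf.eq_of_mem hB' hB₁ (hs hx) (hs₁ hx)
  exact ⟨p, hS, hp⟩

theorem ensure_expand (h : WorkInv L S T (ensureAccess B :: W)) (hB' : B' ∈ T.pack)
    (hs : B ⊆ B') (hp : p ∈ B') : WorkInv L S T (.expand p :: W) := by
  obtain ⟨⟨x, hx⟩, -⟩ := h.items _ List.mem_cons_self
  refine ⟨h.wf, h.root, h.empty_mem, h.reach, h.reach_of_covered, ?_, ?_, ?_⟩
  · intro y hy
    refine (h.closed y hy).imp_right ?_
    rintro ⟨todo, h1, h2⟩
    exact ⟨todo, by simpa using h1, h2⟩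
  · intro B₁ hB₁
    rcases h.access B₁ hB₁ with h1 | ⟨q, hq, hW⟩ | ⟨B₀, hs₁, hW⟩
    · exact Or.inl h1
    · exact Or.inr (Or.inl ⟨q, hq, List.mem_cons_of_mem _ (by simpa using hW)⟩)
    · rcases List.mem_cons.1 hW with hW | hW
      · cases hW
        obtain rfl := h.wf.eq_of_mem hB' hB₁ (hs hx) (hs₁ hx)
        exact Or.inr (Or.inl ⟨p, hp, List.mem_cons_self⟩)
      · exact Or.inr (Or.inr ⟨B₀, hs₁, List.mem_cons_of_mem _ hW⟩)
  · intro i hi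
    rcases List.mem_cons.1 hi with rfl | hi
    · exact h.reach_of_covered p ⟨B', hB', hp⟩
    · exact h.items i (List.mem_cons_of_mem _ hi)

/-- Splitting takes place with an empty worklist only, so no pending `ensureAccess` can refer to a
component that is being cut. The members `z₁` and `z₂` fall into different parts and show that both
are nonempty. -/
theorem refine (h : WorkInv L S T []) {z₁ z₂ : SP A} (hB : B ∈ T.pack) (h₁ : z₁ ∈ B)
    (h₂ : z₂ ∈ B) (hne : ¬ (c.fill z₁ ∈ L ↔ c.fill z₂ ∈ L)) :
    WorkInv L S (T.split L B c)
      [ensureAccess (Store.part₀ L B c), ensureAccess (Store.part₁ L B c)] := by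
  have hpos : (Store.part₀ L B c).Nonempty ∧ (Store.part₁ L B c).Nonempty := by
    by_cases k₁ : c.fill z₁ ∈ L
    · exact ⟨⟨z₂, DTree.mem_part₀.2 ⟨h₂, fun k => hne (iff_of_true k₁ k)⟩⟩,
        ⟨z₁, DTree.mem_part₁.2 ⟨h₁, k₁⟩⟩⟩
    · refine ⟨⟨z₁, DTree.mem_part₀.2 ⟨h₁, k₁⟩⟩, ⟨z₂, DTree.mem_part₁.2 ⟨h₂, ?_⟩⟩⟩
      by_contra k
      exact hne (iff_of_false k₁ k)
  have hmem := DTree.mem_pack_refine_parts (c := c) (B₀ := Store.part₀ L B c)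
    (B₁ := Store.part₁ L B c) hB
  refine ⟨h.wf.split hpos.1 hpos.2, h.root.split L B c, h.empty_mem, h.reach,
    fun x hx => h.reach_of_covered x (DTree.covered_of_covered_split hx), ?_, ?_, ?_⟩
  · intro x hx
    refine Or.inl (DTree.Covered.split ?_ B c)
    simpa using h.closed x hx
  · intro B' hB'
    rcases DTree.mem_pack_refine hB' with ⟨hB', -⟩ | ⟨-, rfl | rfl⟩
    · exact Or.inl (by simpa using h.access B' hB')
    · exact Or.inr (Or.inr ⟨_, subset_rfl, by simp⟩)
    · exact Or.inr (Or.inr ⟨_, subset_rfl, by simp⟩)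
  · intro i hi
    simp only [List.mem_cons, List.not_mem_nil, or_false] at hi
    rcases hi with rfl | rfl
    · exact ⟨hpos.1, _, hmem.1, subset_rfl⟩
    · exact ⟨hpos.2, _, hmem.2, subset_rfl⟩

end WorkInv

/-! ## The phase before the first hypothesis -/

/-- The additional invariant of the phase before the first hypothesis is built: the tree has only
its root as inner node, and no two access sequences lie below the same leaf. -/
structure FirstPhase (L : Set (SP A)) (S : Finset (SP A)) (T : DTree A) (W : List (Control A)) :
    Prop where
  tree : ∃ a b, T = .node Context.hole (.leaf a) (.leaf b)
  inj : ∀ s ∈ S, ∀ s' ∈ S, (s ∈ L ↔ s' ∈ L) → s = s'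
  -- The exception is the moment just after `Expand(ε)` has started: `ε` is in `S` but the tree is
  -- still empty.
  covered : ∀ s ∈ S, T.Covered s ∨ ∃ W', W = expandLoop {s} :: W'
  -- Equality is allowed because `ε` is expanded a second time, when its component is created while
  -- `ε` is already in `S`.
  head : ∀ p W', W = expand p :: W' → ∀ s ∈ S, (s ∈ L ↔ p ∈ L) → s = p
  tail : ∀ p, expand p ∉ W.tail
  no_ensure : ∀ B, ensureAccess B ∉ W

namespace FirstPhase

variable {L : Set (SP A)} {S : Finset (SP A)} {T T' : DTree A} {W : List (Control A)}
  {st : Store A} {p : SP A} {todo todo' : Finset (SP A)}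

theorem sift_eq (h : FirstPhase L S T W) {u v : SP A} (huv : u ∈ L ↔ v ∈ L) :
    T.sift L u = T.sift L v := by
  obtain ⟨a, b, rfl⟩ := h.tree
  refine DTree.sift_congr fun c hc => ?_
  rcases hc with rfl | hc | hc
  · rwa [Context.fill_hole, Context.fill_hole]
  · cases hc
  · cases hc

theorem initial [Fintype A] (L : Set (SP A)) {st : Store A} (hS : st.S = ∅)
    (hT : st.tree = DTree.initial) :
    FirstPhase L (st.addAccess SP.empty).S st.tree (expandItems st SP.empty) := by
  have hmem : ∀ s ∈ (st.addAccess SP.empty).S, s = SP.empty := by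
    intro s hs
    rcases mem_addAccess.1 hs with rfl | hs
    · rfl
    · simp [hS] at hs
  refine ⟨⟨_, _, hT⟩, ?_, ?_, ?_, ?_, ?_⟩
  · intro s hs s' hs' _
    rw [hmem s hs, hmem s' hs']
  · intro s hs
    rw [hmem s hs]
    exact Or.inr ⟨_, rfl⟩
  · rintro p W' ⟨⟩
  · simp [expandItems]
  · simp [expandItems]

theorem expand [Fintype A] (h : FirstPhase L st.S st.tree (.expand p :: W)) :
    FirstPhase L (st.addAccess p).S (st.addAccess p).tree (expandItems st p ++ W) := by
  refine ⟨h.tree, ?_, ?_, ?_, ?_, ?_⟩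
  · intro s hs s' hs' hss
    rcases mem_addAccess.1 hs with h₁ | h₁ <;> rcases mem_addAccess.1 hs' with h₂ | h₂
    · rw [h₁, h₂]
    · rw [h₁] at hss ⊢
      exact (h.head _ _ rfl s' h₂ hss.symm).symm
    · rw [h₂] at hss ⊢
      exact h.head _ _ rfl s h₁ hss
    · exact h.inj s h₁ s' h₂ hss
  · intro s hs
    rcases mem_addAccess.1 hs with rfl | hs
    · exact Or.inr ⟨_, rfl⟩
    · refine Or.inl ((h.covered s hs).resolve_right ?_)
      rintro ⟨W', ⟨⟩⟩
  · rintro q W' ⟨⟩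
  · intro q
    have := h.tail q
    simpa [expandItems] using this
  · intro B
    have := h.no_ensure B
    simpa [expandItems] using this

theorem done (h : FirstPhase L S T (expandLoop ∅ :: W)) : FirstPhase L S T W := by
  refine ⟨h.tree, h.inj, ?_, ?_, ?_, ?_⟩
  · intro s hs
    refine Or.inl ((h.covered s hs).resolve_right ?_)
    rintro ⟨W', h⟩
    have h := (Control.expandLoop.inj (List.cons.inj h).1).symm
    exact Finset.singleton_ne_empty s h
  · rintro p W' rfl
    exact (h.tail p List.mem_cons_self).elim
  · exact fun p hp => h.tail p (List.mem_of_mem_tail hp)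
  · exact fun B hB => h.no_ensure B (List.mem_cons_of_mem _ hB)

theorem all_covered (h : FirstPhase L S T (expandLoop todo :: W)) (hp : p ∈ todo)
    (hmono : ∀ s, T.Covered s → T'.Covered s) (hcp : T'.Covered p) : ∀ s ∈ S, T'.Covered s := by
  intro s hs
  rcases h.covered s hs with hc | ⟨W', h⟩
  · exact hmono s hc
  · cases h
    rwa [← Finset.mem_singleton.1 hp]

theorem known (h : FirstPhase L S T (expandLoop todo :: W)) (hp : p ∈ todo)
    (hT : ∃ a b, T' = .node Context.hole (.leaf a) (.leaf b))
    (hmono : ∀ s, T.Covered s → T'.Covered s) (hcp : T'.Covered p) :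
    FirstPhase L S T' (expandLoop todo' :: W) := by
  refine ⟨hT, h.inj, fun s hs => Or.inl (h.all_covered hp hmono hcp s hs), ?_, h.tail, ?_⟩
  · rintro q W' ⟨⟩
  · intro B
    have := h.no_ensure B
    simpa using this

theorem tree_insert (h : FirstPhase L S T W) (p : SP A) :
    ∃ a b, T.insert L p = .node Context.hole (.leaf a) (.leaf b) := by
  obtain ⟨a, b, rfl⟩ := h.tree
  have hleaf : ∀ o : Option (Component A),
      ∃ o', (DTree.leaf o).insert L p = DTree.leaf o' := by
    rintro (_ | B)
    · exact ⟨_, rfl⟩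
    · exact ⟨_, rfl⟩
  by_cases hc : Context.hole.fill p ∈ L
  · obtain ⟨o, ho⟩ := hleaf b
    exact ⟨a, o, by rw [DTree.insert_node_of_mem hc, ho]⟩
  · obtain ⟨o, ho⟩ := hleaf a
    exact ⟨o, b, by rw [DTree.insert_node_of_notMem hc, ho]⟩

theorem insert_known (h : FirstPhase L S T (expandLoop todo :: W)) (hp : p ∈ todo) :
    FirstPhase L S (T.insert L p) (expandLoop todo' :: W) :=
  h.known hp (h.tree_insert p) (fun _ hs => hs.insert) (DTree.covered_insert_self L p T)

theorem insert_new (h : FirstPhase L S T (expandLoop todo :: W)) (hT : T.WF L) (hp : p ∈ todo)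
    (hs : T.sift L p = none) :
    FirstPhase L S (T.insert L p) (.expand p :: expandLoop todo' :: W) := by
  refine ⟨h.tree_insert p, h.inj, fun s hs => Or.inl (h.all_covered hp (fun _ hs => hs.insert)
    (DTree.covered_insert_self L p T) s hs), ?_, ?_, ?_⟩
  · rintro q W' hq s hsS hsp
    cases hq
    -- If `s` is covered, its leaf is labelled, whereas `p`, on the same side of `L`, reaches an
    -- unlabelled leaf. Otherwise the loop runs over `{s}` and `p` is `s`.
    rcases h.covered s hsS with ⟨B, hB, hsB⟩ | ⟨W', h⟩
    · have := hT.sift_eq hB hsB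
      rw [h.sift_eq hsp, hs] at this
      cases this
    · cases h
      exact (Finset.mem_singleton.1 hp).symm
  · intro q
    have := h.tail q
    simpa using this
  · intro B
    have := h.no_ensure B
    simpa using this

end FirstPhase

/-! ## Existence of hypotheses -/

namespace WorkInv

variable {L : Set (SP A)} {S : Finset (SP A)} {T : DTree A} {st : Store A}

theorem covered (h : WorkInv L S T []) {x : SP A} (hx : Target S x) : T.Covered x := by
  simpa using h.closed x hx

theorem covered_op (h : WorkInv L S T []) (o : Op) {u v : SP A} (hu : u ∈ S) (hv : v ∈ S) :
    T.Covered (SP.op o u v) :=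
  h.covered (Or.inr (Or.inr ⟨o, u, hu, v, hv, rfl⟩))

theorem exists_access (h : WorkInv L S T []) {B : Component A} (hB : B ∈ T.pack) :
    ∃ s ∈ S, s ∈ B := by
  simpa using h.access B hB

/-- Closedness provides products of representatives, consistency makes them independent of the
representatives, and the absence of associativity defects gives associativity. Commutativity and the
neutral laws are inherited from pomsets. -/
theorem exists_isHypothesis (h : WorkInv L st.S st.tree [])
    (hc : ¬ ∃ B u v e, st.ConsistencyDefect L B u v e)
    (ha : ¬ ∃ o s₁ s₂ s₃ sl sr, st.AssocDefect L o s₁ s₂ s₃ sl sr) :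
    ∃ H, st.IsHypothesis L H := by
  choose rep hrepS hrep using fun B : {B // B ∈ st.tree.pack} => h.exists_access B.2
  have hcomp : ∀ x, Target st.S x → ∃ B : {B // B ∈ st.tree.pack}, x ∈ B.1 := fun x hx =>
    let ⟨B, hB, hxB⟩ := h.covered hx
    ⟨⟨B, hB⟩, hxB⟩
  have huniq : ∀ (x : SP A) (B B' : {B // B ∈ st.tree.pack}), x ∈ B.1 → x ∈ B'.1 → B = B' :=
    fun x B B' hx hx' => Subtype.ext (h.wf.eq_of_mem B.2 B'.2 hx hx')
  choose op hop using fun (o : Op) (B₁ B₂ : {B // B ∈ st.tree.pack}) =>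
    hcomp (SP.op o (rep B₁) (rep B₂))
      (Or.inr (Or.inr ⟨o, _, hrepS B₁, _, hrepS B₂, rfl⟩))
  choose ini hini using fun a : A => hcomp (SP.letter a) (Or.inr (Or.inl ⟨a, rfl⟩))
  obtain ⟨one, hone⟩ := hcomp SP.empty (Or.inl h.empty_mem)
  have key : ∀ (o : Op) (B₁ B₂ : {B // B ∈ st.tree.pack}), ∀ u ∈ st.S, ∀ v ∈ st.S,
      u ∈ B₁.1 → v ∈ B₂.1 → SP.op o u v ∈ (op o B₁ B₂).1 := by
    intro o B₁ B₂ u hu v hv huB hvB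
    refine h.wf.mem_of_sift (h.covered_op o hu hv) ?_
    -- The factors are replaced by representatives one at a time, each replacement excluding one
    -- kind of consistency defect.
    have h1 : st.tree.sift L (SP.op o u v) = st.tree.sift L (SP.op o (rep B₁) v) := by
      by_contra hne
      exact hc ⟨_, _, _, _, .left o B₁.1 u (rep B₁) v B₁.2 hu huB (hrepS _) (hrep _) hv hne⟩
    have h2 : st.tree.sift L (SP.op o (rep B₁) v) =
        st.tree.sift L (SP.op o (rep B₁) (rep B₂)) := by
      by_contra hne
      exact hc ⟨_, _, _, _,
        .right o B₂.1 v (rep B₂) (rep B₁) B₂.2 hv hvB (hrepS _) (hrep _) (hrepS _) hne⟩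
    rw [h1, h2]
    exact h.wf.sift_eq (op o B₁ B₂).2 (hop o B₁ B₂)
  refine ⟨⟨st.tree.pack, ⟨inferInstance, op, one, ?_, ?_, ?_, ?_, ini,
    {B | ∀ s ∈ B.1, s ∈ L}⟩⟩, rfl, key, hone, hini, rfl⟩
  · intro o B₁ B₂ B₃
    have h1 := h.wf.sift_eq (op o B₁ (op o B₂ B₃)).2 (hop o B₁ (op o B₂ B₃))
    have h2 := h.wf.sift_eq (op o (op o B₁ B₂) B₃).2 (hop o (op o B₁ B₂) B₃)
    have h3 : st.tree.sift L (SP.op o (rep B₁) (rep (op o B₂ B₃))) =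
        st.tree.sift L (SP.op o (rep (op o B₁ B₂)) (rep B₃)) := by
      by_contra hne
      exact ha ⟨o, rep B₁, rep B₂, rep B₃, rep (op o B₁ B₂), rep (op o B₂ B₃), hrepS _,
        hrepS _, hrepS _, ⟨hrepS _, _, (op o B₁ B₂).2, hop _ _ _, hrep _⟩,
        ⟨hrepS _, _, (op o B₂ B₃).2, hop _ _ _, hrep _⟩, hne⟩
    exact Subtype.ext (Option.some_injective _ (h2.symm.trans (h3.symm.trans h1)))
  · intro B₁ B₂
    refine huniq _ _ _ (hop .par B₁ B₂) ?_
    rw [SP.par_comm]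
    exact hop .par B₂ B₁
  · intro o B
    refine huniq (rep B) _ _ ?_ (hrep B)
    have := key o one B _ h.empty_mem _ (hrepS B) hone (hrep B)
    rwa [SP.empty_op] at this
  · intro o B
    refine huniq (rep B) _ _ ?_ (hrep B)
    have := key o B one _ (hrepS B) _ h.empty_mem (hrep B) hone
    rwa [SP.op_empty] at this

end WorkInv

namespace FirstPhase

variable {L : Set (SP A)} {st : Store A}

/-- Two access sequences of one component agree on membership in `L`, hence coincide in this phase.
-/
theorem no_consistencyDefect (h : FirstPhase L st.S st.tree []) (hw : WorkInv L st.S st.tree []) :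
    ¬ ∃ B u v e, st.ConsistencyDefect L B u v e := by
  rintro ⟨B, u, v, e, hd⟩
  cases hd with
  | left o B p₁ p₂ p hB hp₁ h₁ hp₂ h₂ hp hs =>
    obtain rfl := h.inj p₁ hp₁ p₂ hp₂ (hw.root.mem_iff hw.wf hB h₁ h₂)
    exact hs rfl
  | right o B p₁ p₂ p hB hp₁ h₁ hp₂ h₂ hp hs =>
    obtain rfl := h.inj p₁ hp₁ p₂ hp₂ (hw.root.mem_iff hw.wf hB h₁ h₂)
    exact hs rfl

/-- `S` contains `ε` and at most one other pomset. If one of the three factors is `ε`, the neutral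
laws apply; otherwise all three are equal, `sl = sr`, and this common value is `ε` or the same
pomset again. -/
theorem no_assocDefect (h : FirstPhase L st.S st.tree []) (hw : WorkInv L st.S st.tree []) :
    ¬ ∃ o s₁ s₂ s₃ sl sr, st.AssocDefect L o s₁ s₂ s₃ sl sr := by
  rintro ⟨o, s₁, s₂, s₃, sl, sr, h₁, h₂, h₃, ⟨hl, B, hB, hlB, hlB'⟩, ⟨hr, C, hC, hrC, hrC'⟩, hs⟩
  have hl' := hw.root.mem_iff hw.wf hB hlB' hlB
  have hr' := hw.root.mem_iff hw.wf hC hrC' hrC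
  refine hs (h.sift_eq ?_)
  have he := hw.empty_mem
  by_cases e₁ : s₁ = SP.empty
  · subst e₁
    rw [SP.empty_op] at hl' ⊢
    obtain rfl := h.inj _ hl _ h₂ hl'
    exact hr'
  by_cases e₃ : s₃ = SP.empty
  · subst e₃
    rw [SP.op_empty] at hr' ⊢
    obtain rfl := h.inj _ hr _ h₂ hr'
    exact hl'.symm
  by_cases e₂ : s₂ = SP.empty
  · subst e₂
    rw [SP.op_empty] at hl'
    rw [SP.empty_op] at hr'
    rw [h.inj _ hl _ h₁ hl', h.inj _ hr _ h₃ hr']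
  -- Each access sequence other than `ε` lies on the side of `L` opposite to `ε`, and each side
  -- holds at most one.
  have huniq : ∀ u ∈ st.S, ∀ v ∈ st.S, u ≠ SP.empty → v ≠ SP.empty → u = v := by
    intro u hu v hv hu0 hv0
    have h1 := fun k => hu0 (h.inj u hu _ he k)
    have h2 := fun k => hv0 (h.inj v hv _ he k)
    exact h.inj u hu v hv (by tauto)
  obtain rfl := huniq s₁ h₁ s₂ h₂ e₁ e₂
  obtain rfl := huniq s₁ h₁ s₃ h₃ e₁ e₃
  obtain rfl := h.inj _ hl _ hr (hl'.trans hr'.symm)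
  by_cases e : sl = SP.empty
  · rw [e, SP.empty_op, SP.op_empty]
  · rw [huniq sl hl s₁ h₁ e e₁]

end FirstPhase

/-! ## Properties of hypotheses -/

/-- The learner has an up-to-date hypothesis. -/
structure Ready (L : Set (SP A)) (st : Store A) (H : Hypothesis A) : Prop where
  hyp : st.hyp = some H
  work : WorkInv L st.S st.tree []
  isHyp : st.IsHypothesis L H

namespace Ready

variable {L : Set (SP A)} {st : Store A} {H : Hypothesis A} {c : Context A} {p : SP A}

theorem mem_pack (h : Ready L st H) (B : {B // B ∈ H.pack}) : B.1 ∈ st.tree.pack :=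
  h.isHyp.1 ▸ B.2

/-- The product of `H` is prescribed only through access sequences. The induction succeeds because
all intermediate pomsets in `Reach` lie in `S`. -/
theorem exists_eval_of_reach (h : Ready L st H) (hp : Reach st.S p) :
    ∃ B, H.recognizer.Eval p B ∧ p ∈ B.1 := by
  induction hp with
  | empty => exact ⟨_, .empty, h.isHyp.2.2.1⟩
  | letter a => exact ⟨_, .letter a, h.isHyp.2.2.2.1 a⟩
  | op o hu hv _ _ hu' hv' =>
    obtain ⟨B₁, h₁, k₁⟩ := hu'
    obtain ⟨B₂, h₂, k₂⟩ := hv'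
    exact ⟨_, .op o h₁ h₂, h.isHyp.2.1 o B₁ B₂ _ hu _ hv k₁ k₂⟩

/-- Members of components are reachable, so they evaluate to a component containing them, and
components are disjoint. -/
theorem eval_of_mem (h : Ready L st H) {B : {B // B ∈ H.pack}} (hp : p ∈ B.1) :
    H.recognizer.Eval p B := by
  obtain ⟨B', h', hp'⟩ :=
    h.exists_eval_of_reach (h.work.reach_of_covered p ⟨B.1, h.mem_pack B, hp⟩)
  rwa [Subtype.ext (h.work.wf.eq_of_mem (h.mem_pack B) (h.mem_pack B') hp hp')]

theorem agreesOn_of_mem (h : Ready L st H) (hp : p ∈ st.S) : H.AgreesOn L p := by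
  obtain ⟨B, hB, hpB⟩ := h.exists_eval_of_reach (h.work.reach p hp)
  refine (Recognizer.mem_language_iff hB).trans ?_
  rw [h.isHyp.2.2.2.2]
  refine ⟨fun k => k p hpB, fun k s hs => ?_⟩
  exact (h.work.root.mem_iff h.work.wf (h.mem_pack B) hs hpB).2 k

theorem agree_hole (h : Ready L st H) (z : SP A) : st.Agree L H Context.hole z := by
  intro p hp
  rw [Context.fill_hole]
  exact h.agreesOn_of_mem hp.1

theorem empty_mem_hypAccess (h : Ready L st H) : SP.empty ∈ st.hypAccess H SP.empty :=
  ⟨h.work.empty_mem, _, .empty, h.isHyp.2.2.1⟩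

/-- An access sequence of `z₁` or `z₂` in `H` has the same value in `H` as the factor it replaces,
so `p₁ ∘ p₂` has no access sequences beyond those of `z₁ ∘ z₂`. -/
theorem agree_op (h : Ready L st H) {o : Op} {z₁ z₂ p₁ p₂ : SP A}
    (hz : st.Agree L H c (SP.op o z₁ z₂)) (h₁ : p₁ ∈ st.hypAccess H z₁)
    (h₂ : p₂ ∈ st.hypAccess H z₂) : st.Agree L H c (SP.op o p₁ p₂) := by
  obtain ⟨-, B₁, hB₁, hp₁⟩ := h₁
  obtain ⟨-, B₂, hB₂, hp₂⟩ := h₂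
  rintro q ⟨hq, B, hB, hqB⟩
  refine hz q ⟨hq, B, ?_, hqB⟩
  rw [hB.unique (.op o (h.eval_of_mem hp₁) (h.eval_of_mem hp₂))]
  exact .op o hB₁ hB₂

/-- What `FindEBP` returns is not contextually equivalent to any access sequence. -/
theorem fresh (h : Ready L st H) {M : Type*} {κ : SP A → M}
    (hκ : ∀ u v, κ u = κ v → ∀ c : Context A, c.fill u ∈ L ↔ c.fill v ∈ L)
    (hp : Reach st.S p) (ha : st.Agree L H c p) (hd : ¬ H.AgreesOn L (c.fill p)) :
    ∀ s ∈ st.S, κ s ≠ κ p := by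
  intro s hs he
  obtain ⟨B, hB, hpB⟩ := h.exists_eval_of_reach hp
  obtain ⟨B', hB', hsB'⟩ := h.exists_eval_of_reach (h.work.reach s hs)
  -- Equal `κ`-values give the same answer at every node. As `s` and `p` belong to components, these
  -- components coincide, and `s` becomes an access sequence of `p` in `H`.
  have hsift : st.tree.sift L s = st.tree.sift L p :=
    DTree.sift_congr fun c _ => hκ s p he c
  rw [h.work.wf.sift_eq (h.mem_pack B) hpB, h.work.wf.sift_eq (h.mem_pack B') hsB'] at hsift
  obtain rfl : B' = B := Subtype.ext (Option.some_injective _ hsift)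
  refine hd ?_
  have h1 := ha s ⟨hs, B', hB, hsB'⟩
  exact (Recognizer.fill_mem_language_iff hB hB' c).trans (h1.trans (hκ s p he c))

end Ready

open Config

/-! ## The invariant of the learner -/

/-- The rest of the control stack while `HandleCE` is running. -/
abbrev handleStack (A : Type*) : List (Control A) := [handleLoop, compatLoop, mainLoop]

/-- The control points of `MakeConsistent` and `MakeAssoc` to which a call of `Refine` or
`Expand` returns. -/
inductive Pending : Control A → Prop
  | consistent (b : Bool) : Pending (makeConsistent b)
  | assoc (b b' : Bool) : (b && b') = false → Pending (makeAssoc b b')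

/-- The invariant of the learner, by the shape of the control stack. -/
inductive Inv (L : Set (SP A)) : Config A → Prop
  | startExpand (p : SP A) (W : List (Control A)) (st : Store A) :
      WorkInv L st.S st.tree (expand p :: W) → FirstPhase L st.S st.tree (expand p :: W) →
      Inv L (running (expand p :: (W ++ [buildHypothesis, mainLoop])) st)
  | startLoop (todo : Finset (SP A)) (W : List (Control A)) (st : Store A) :
      WorkInv L st.S st.tree (expandLoop todo :: W) →
      FirstPhase L st.S st.tree (expandLoop todo :: W) →
      Inv L (running (expandLoop todo :: (W ++ [buildHypothesis, mainLoop])) st)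
  | startBuild (st : Store A) : WorkInv L st.S st.tree [] → FirstPhase L st.S st.tree [] →
      Inv L (running [buildHypothesis, mainLoop] st)
  | workExpand (p : SP A) (W : List (Control A)) (t : Control A) (st : Store A) :
      WorkInv L st.S st.tree (expand p :: W) → Pending t →
      Inv L (running (expand p :: (W ++ t :: buildHypothesis :: handleStack A)) st)
  | workLoop (todo : Finset (SP A)) (W : List (Control A)) (t : Control A) (st : Store A) :
      WorkInv L st.S st.tree (expandLoop todo :: W) → Pending t →
      Inv L (running (expandLoop todo :: (W ++ t :: buildHypothesis :: handleStack A)) st)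
  | workEnsure (B : Component A) (W : List (Control A)) (t : Control A) (st : Store A) :
      WorkInv L st.S st.tree (ensureAccess B :: W) → Pending t →
      Inv L (running (ensureAccess B :: (W ++ t :: buildHypothesis :: handleStack A)) st)
  | consistent (b : Bool) (st : Store A) : WorkInv L st.S st.tree [] →
      Inv L (running (makeConsistent b :: buildHypothesis :: handleStack A) st)
  | assoc (b b' : Bool) (st : Store A) : WorkInv L st.S st.tree [] →
      (b = true → b' = true → ¬ ∃ B u v e, st.ConsistencyDefect L B u v e) →
      Inv L (running (makeAssoc b b' :: buildHypothesis :: handleStack A) st)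
  | refine (B : Component A) (c : Context A) (z₁ z₂ : SP A) (t : Control A) (st : Store A) :
      WorkInv L st.S st.tree [] → Pending t → B ∈ st.tree.pack → z₁ ∈ B → z₂ ∈ B →
      ¬ (c.fill z₁ ∈ L ↔ c.fill z₂ ∈ L) →
      Inv L (running (refine B c :: t :: buildHypothesis :: handleStack A) st)
  | build (st : Store A) : WorkInv L st.S st.tree [] →
      (¬ ∃ B u v e, st.ConsistencyDefect L B u v e) →
      (¬ ∃ o s₁ s₂ s₃ sl sr, st.AssocDefect L o s₁ s₂ s₃ sl sr) →
      Inv L (running (buildHypothesis :: handleStack A) st)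
  | main (st : Store A) (H : Hypothesis A) : Ready L st H → Inv L (running [mainLoop] st)
  | compat (st : Store A) (H : Hypothesis A) : Ready L st H →
      Inv L (running [compatLoop, mainLoop] st)
  | handleCE (w : SP A) (st : Store A) (H : Hypothesis A) : Ready L st H → ¬ H.AgreesOn L w →
      Inv L (running [handleCE w, compatLoop, mainLoop] st)
  | handleLoop (st : Store A) (H : Hypothesis A) : Ready L st H →
      Inv L (running (handleStack A) st)
  | find (c : Context A) (z : SP A) (st : Store A) (H : Hypothesis A) : Ready L st H →
      st.Agree L H c z → ¬ H.AgreesOn L (c.fill z) →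
      Inv L (running (findEBP c z :: handleStack A) st)
  | found (c : Context A) (p : SP A) (st : Store A) (H : Hypothesis A) : Ready L st H →
      Reach st.S p → st.Agree L H c p → ¬ H.AgreesOn L (c.fill p) →
      Inv L (running (foundEBP c p :: handleStack A) st)
  | returned (H : Hypothesis A) : H.language = L → Inv L (returned H)

namespace Inv

variable {L : Set (SP A)} {st : Store A} {W : List (Control A)} {t : Control A}

/-- When an item has been processed, the next configuration is determined by the head of the
remaining worklist; `ItemOK` excludes all other control points. -/
theorem start (h : WorkInv L st.S st.tree W) (hf : FirstPhase L st.S st.tree W) :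
    Inv L (running (W ++ [buildHypothesis, mainLoop]) st) := by
  cases W with
  | nil => exact .startBuild st h hf
  | cons i W =>
    have hi := h.items i List.mem_cons_self
    cases i with
    | expand p => exact .startExpand p W st h hf
    | expandLoop todo => exact .startLoop todo W st h hf
    | ensureAccess B => exact absurd List.mem_cons_self (hf.no_ensure B)
    | _ => exact hi.elim

theorem pending (h : WorkInv L st.S st.tree []) (ht : Pending t) :
    Inv L (running (t :: buildHypothesis :: handleStack A) st) := by
  cases ht with
  | consistent b => exact .consistent b st h
  | assoc b b' hb =>
    refine .assoc b b' st h ?_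
    rintro rfl rfl
    cases hb

theorem work (h : WorkInv L st.S st.tree W) (ht : Pending t) :
    Inv L (running (W ++ t :: buildHypothesis :: handleStack A) st) := by
  cases W with
  | nil => exact .pending h ht
  | cons i W =>
    have hi := h.items i List.mem_cons_self
    cases i with
    | expand p => exact .workExpand p W t st h ht
    | expandLoop todo => exact .workLoop todo W t st h ht
    | ensureAccess B => exact .workEnsure B W t st h ht
    | _ => exact hi.elim

theorem wf {k : List (Control A)} (h : Inv L (running k st)) : st.tree.WF L := by
  cases h with
  | main _ _ h | compat _ _ h | handleCE _ _ _ h | handleLoop _ _ h | find _ _ _ _ h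
  | found _ _ _ _ h => exact h.work.wf
  | _ => exact WorkInv.wf (by assumption)

/-- Steps preserve the invariant. -/
theorem step [Fintype A] {cfg cfg' : Config A} (hI : Inv L cfg) (hs : Step L cfg cfg') :
    Inv L cfg' := by
  cases hs with
  | expand w k st =>
    cases hI with
    | startExpand _ W _ h hf => exact Inv.start h.expand hf.expand
    | workExpand _ W t _ h ht => exact Inv.work h.expand ht
  | expand_done k st =>
    cases hI with
    | startLoop _ W _ h hf => exact Inv.start h.done hf.done
    | workLoop _ W t _ h ht => exact Inv.work h.done ht
  | expand_known p todo todo' k st hp htodo hc =>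
    cases hI with
    | startLoop _ W _ h hf =>
      exact .startLoop _ _ _ (h.known htodo hc) (hf.known hp hf.tree (fun _ hs => hs) hc)
    | workLoop _ W t _ h ht => exact .workLoop _ _ _ _ (h.known htodo hc) ht
  | expand_insert p todo todo' k st B hp htodo _ hs =>
    cases hI with
    | startLoop _ W _ h hf =>
      exact .startLoop _ _ _ (h.insert_known hp htodo hs) (hf.insert_known hp)
    | workLoop _ W t _ h ht => exact .workLoop _ _ _ _ (h.insert_known hp htodo hs) ht
  | expand_new p todo todo' k st hp htodo _ hs =>
    cases hI with
    | startLoop _ W _ h hf =>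
      exact .startExpand p (expandLoop todo' :: W) _ (h.insert_new hp htodo)
        (hf.insert_new h.wf hp hs)
    | workLoop _ W t _ h ht =>
      exact .workExpand p (expandLoop todo' :: W) t _ (h.insert_new hp htodo) ht
  | refine B c z₁ z₂ k st hB h₁ h₂ hne =>
    cases hI with
    | refine _ _ _ _ t _ h ht =>
      exact Inv.work (st := { st with tree := st.tree.split L B c }) (h.refine hB h₁ h₂ hne) ht
  | ensure_skip B B' s k st hB' hs hS hsB =>
    cases hI with
    | workEnsure _ W t _ h ht => exact Inv.work (h.ensure_skip hB' hs hS hsB) ht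
  | ensure_expand B B' p k st hB' hs _ hp =>
    cases hI with
    | workEnsure _ W t _ h ht => exact .workExpand p W t _ (h.ensure_expand hB' hs hp) ht
  | consistent_refine B u v c e already k st hd hc hne =>
    cases hI with
    | consistent _ _ h =>
      cases hd with
      | left o _ p₁ p₂ p hB hp₁ h₁ hp₂ h₂ hp hs =>
        refine .refine B _ p₁ p₂ _ st h (.consistent false) hB h₁ h₂ ?_
        rwa [Context.fill_comp, Context.fill_comp, Context.fill_holeLeft, Context.fill_holeLeft]
      | right o _ p₁ p₂ p hB hp₁ h₁ hp₂ h₂ hp hs =>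
        refine .refine B _ p₁ p₂ _ st h (.consistent false) hB h₁ h₂ ?_
        rwa [Context.fill_comp, Context.fill_comp, Context.fill_holeRight,
          Context.fill_holeRight]
  | consistent_done already k st hd =>
    cases hI with
    | consistent _ _ h => exact .assoc _ _ _ h fun _ _ => hd
  | consistent_again k st hd =>
    cases hI with
    | consistent _ _ h => exact .consistent _ _ h
  | assoc_left o s₁ s₂ s₃ sl sr c B b b' k st hd hc h₁ h₂ hB hm =>
    cases hI with
    | assoc _ _ _ h =>
      obtain ⟨-, -, -, ⟨-, B', hB', hm', hl⟩, -, -⟩ := hd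
      -- The component to be refined is the one that contains both `s₁ ∘ s₂` and `sl`, and these two
      -- are the witnesses that it really splits.
      obtain rfl := h.wf.eq_of_mem hB hB' hm hm'
      refine .refine B _ sl (SP.op o s₁ s₂) _ st h (.assoc b false (Bool.and_false b)) hB hl hm ?_
      rwa [Context.fill_comp, Context.fill_comp, Context.fill_holeLeft, Context.fill_holeLeft]
  | assoc_right o s₁ s₂ s₃ sl sr c B b b' k st hd hc h₁ h₂ hB hm =>
    cases hI with
    | assoc _ _ _ h =>
      obtain ⟨-, -, -, -, ⟨-, B', hB', hm', hr⟩, -⟩ := hd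
      obtain rfl := h.wf.eq_of_mem hB hB' hm hm'
      refine .refine B _ sr (SP.op o s₂ s₃) _ st h (.assoc b false (Bool.and_false b)) hB hr hm ?_
      -- Since `sl ∘ s₃` and the triple product behave alike under `c`, the discrepancy must lie
      -- between `s₁ ∘ sr` and `s₁ ∘ (s₂ ∘ s₃)`.
      rw [SP.op_assoc] at h₂
      rw [Context.fill_comp, Context.fill_comp, Context.fill_holeRight, Context.fill_holeRight]
      exact fun h => h₁ (h.trans h₂.symm)
  | assoc_done k st hd =>
    cases hI with
    | assoc _ _ _ h hc => exact .build _ h (hc rfl rfl) hd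
  | assoc_again b b' k st hd _ =>
    cases hI with
    | assoc _ _ _ h hc => exact .consistent _ _ h
  | build H k st hH =>
    cases hI with
    | startBuild _ h => exact .main _ H ⟨rfl, h, hH⟩
    | build _ h => exact .handleLoop _ H ⟨rfl, h, hH⟩
  | ebp_letter c a k st =>
    cases hI with
    | find _ _ _ H h ha hd => exact .found _ _ _ H h (.letter a) ha hd
  | ebp_left H c z o z₁ z₂ k st hH hz ha =>
    cases hI with
    | find _ _ _ H' h _ hd =>
      obtain rfl : H' = H := Option.some_injective _ (h.hyp.symm.trans hH)
      refine .find _ _ _ H' h ha ?_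
      rwa [Context.fill_comp, Context.fill_holeLeft, ← hz.eq_op]
  | ebp_right H c z o z₁ z₂ p₁ k st hH hz _ hp₁ hd₁ ha =>
    cases hI with
    | find _ _ _ H' h _ hd =>
      obtain rfl : H' = H := Option.some_injective _ (h.hyp.symm.trans hH)
      refine .find _ _ _ H' h ha ?_
      rwa [Context.fill_comp, Context.fill_holeRight]
  | ebp_found H c z o z₁ z₂ p₁ p₂ k st hH hz _ hp₁ _ _ hp₂ hd₂ =>
    cases hI with
    | find _ _ _ H' h ha hd =>
      obtain rfl : H' = H := Option.some_injective _ (h.hyp.symm.trans hH)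
      rw [hz.eq_op] at ha
      exact .found _ _ _ H' h (.op o hp₁.1 hp₂.1 (h.work.reach _ hp₁.1) (h.work.reach _ hp₂.1))
        (h.agree_op ha hp₁ hp₂) hd₂
  | handle w k st =>
    cases hI with
    | handleCE _ _ H h _ => exact .handleLoop _ H ⟨h.hyp, h.work, h.isHyp⟩
  | handle_find H u k st hH hu hd =>
    cases hI with
    | handleLoop _ H' h =>
      obtain rfl : H' = H := Option.some_injective _ (h.hyp.symm.trans hH)
      refine .find _ _ _ H' h (h.agree_hole u) ?_
      rwa [Context.fill_hole]
  | handle_found H c p k st hH =>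
    cases hI with
    | found _ _ _ H' h hp ha hd =>
      refine .workExpand p [] _ (st.addPool H c p) ?_ (.consistent true)
      have hw := h.work
      refine ⟨hw.wf, hw.root, hw.empty_mem, hw.reach, hw.reach_of_covered,
        fun x hx => Or.inl (hw.covered hx), fun B hB => Or.inl (hw.exists_access hB), ?_⟩
      intro i hi
      obtain rfl := List.mem_singleton.1 hi
      exact hp
  | handle_done H k st hH _ =>
    cases hI with
    | handleLoop _ H' h => exact .compat _ H' h
  | learn_counterexample H w k st hH hd =>
    cases hI with
    | main _ H' h =>
      obtain rfl : H' = H := Option.some_injective _ (h.hyp.symm.trans hH)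
      exact .handleCE _ _ H' h hd
  | compat_handle H B s c k st hH _ _ _ hd =>
    cases hI with
    | compat _ H' h =>
      obtain rfl : H' = H := Option.some_injective _ (h.hyp.symm.trans hH)
      exact .handleCE _ _ H' h hd
  | compat_done H k st hH _ =>
    cases hI with
    | compat _ H' h => exact .main _ H' h
  | learn_return H st _ hL => exact .returned H hL

/-! ### Absence of deadlocks -/

theorem exists_erase {todo : Finset (SP A)} (p : SP A) :
    ∃ todo' : Finset (SP A), ∀ x, x ∈ todo' ↔ x ∈ todo ∧ x ≠ p := by
  classical
  exact ⟨todo.erase p, fun x => by rw [Finset.mem_erase, and_comm]⟩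

theorem exists_step_expandLoop [Fintype A] (todo : Finset (SP A)) (k : List (Control A))
    (st : Store A) : ∃ cfg, Step L (running (expandLoop todo :: k) st) cfg := by
  rcases todo.eq_empty_or_nonempty with rfl | ⟨p, hp⟩
  · exact ⟨_, .expand_done k st⟩
  · obtain ⟨todo', h'⟩ := exists_erase (todo := todo) p
    by_cases hc : ∃ B ∈ st.tree.pack, p ∈ B
    · exact ⟨_, .expand_known p todo todo' k st hp h' hc⟩
    · cases hs : st.tree.sift L p with
      | some B => exact ⟨_, .expand_insert p todo todo' k st B hp h' hc hs⟩
      | none => exact ⟨_, .expand_new p todo todo' k st hp h' hc hs⟩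

theorem exists_context {T : DTree A} {u v : SP A} (h : T.sift L u ≠ T.sift L v) :
    ∃ c ∈ T.contexts, ¬ (c.fill u ∈ L ↔ c.fill v ∈ L) := by
  by_contra! hc
  exact h (DTree.sift_congr hc)

/-- The learner does not get stuck. -/
theorem exists_step [Fintype A] {k : List (Control A)} (h : Inv L (running k st)) :
    ∃ cfg, Step L (running k st) cfg := by
  cases h with
  | startExpand p W _ _ _ => exact ⟨_, .expand p _ st⟩
  | startLoop todo W _ _ _ => exact exists_step_expandLoop _ _ _
  | startBuild _ hw hf =>
    obtain ⟨H, hH⟩ := hw.exists_isHypothesis (hf.no_consistencyDefect hw) (hf.no_assocDefect hw)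
    exact ⟨_, .build H _ st hH⟩
  | workExpand p W t _ _ _ => exact ⟨_, .expand p _ st⟩
  | workLoop todo W t _ _ _ => exact exists_step_expandLoop _ _ _
  | workEnsure B W t _ hw _ =>
    obtain ⟨⟨x, hx⟩, B', hB', hs⟩ := hw.items _ List.mem_cons_self
    by_cases hS : ∃ s ∈ st.S, s ∈ B'
    · obtain ⟨s, hs', hsB⟩ := hS
      exact ⟨_, .ensure_skip B B' s _ st hB' hs hs' hsB⟩
    · exact ⟨_, .ensure_expand B B' x _ st hB' hs (fun s h1 h2 => hS ⟨s, h1, h2⟩) (hs hx)⟩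
  | consistent b _ hw =>
    by_cases hd : ∃ B u v e, st.ConsistencyDefect L B u v e
    · obtain ⟨B, u, v, e, hd⟩ := hd
      have hsep : st.Separated L u v := by cases hd <;> assumption
      obtain ⟨c, hc, hne⟩ := exists_context hsep
      exact ⟨_, .consistent_refine B u v c e b _ st hd hc hne⟩
    · exact ⟨_, .consistent_done b _ st hd⟩
  | assoc b b' _ hw _ =>
    by_cases hd : ∃ o s₁ s₂ s₃ sl sr, st.AssocDefect L o s₁ s₂ s₃ sl sr
    · obtain ⟨o, s₁, s₂, s₃, sl, sr, hd⟩ := hd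
      obtain ⟨c, hc, hne⟩ := exists_context hd.2.2.2.2.2
      obtain ⟨-, B, hB, hm, -⟩ := hd.2.2.2.1
      obtain ⟨-, C, hC, hm', -⟩ := hd.2.2.2.2.1
      by_cases h : c.fill (SP.op o sl s₃) ∈ L ↔ c.fill (SP.op o (SP.op o s₁ s₂) s₃) ∈ L
      · exact ⟨_, .assoc_right o s₁ s₂ s₃ sl sr c C b b' _ st hd hc hne h hC hm'⟩
      · exact ⟨_, .assoc_left o s₁ s₂ s₃ sl sr c B b b' _ st hd hc hne h hB hm⟩
    · cases hb : b && b' with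
      | true =>
        obtain ⟨rfl, rfl⟩ := Bool.and_eq_true_iff.1 hb
        exact ⟨_, .assoc_done _ st hd⟩
      | false => exact ⟨_, .assoc_again b b' _ st hd hb⟩
  | refine B c z₁ z₂ t _ _ _ hB h₁ h₂ hne => exact ⟨_, .refine B c z₁ z₂ _ st hB h₁ h₂ hne⟩
  | build _ hw hc ha =>
    obtain ⟨H, hH⟩ := hw.exists_isHypothesis hc ha
    exact ⟨_, .build H _ st hH⟩
  | main _ H h =>
    by_cases hL : H.language = L
    · exact ⟨_, .learn_return H st h.hyp hL⟩
    · obtain ⟨w, hw⟩ : ∃ w, ¬ H.AgreesOn L w := by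
        by_contra! hc
        exact hL (Set.ext hc)
      exact ⟨_, .learn_counterexample H w _ st h.hyp hw⟩
  | compat _ H h =>
    by_cases hc : ∀ B ∈ st.tree.pack, ∀ s ∈ B, ∀ c ∈ st.tree.branchContexts B,
        H.AgreesOn L (c.fill s)
    · exact ⟨_, .compat_done H _ st h.hyp hc⟩
    · push Not at hc
      obtain ⟨B, hB, s, hs, c, hc, hd⟩ := hc
      exact ⟨_, .compat_handle H B s c _ st h.hyp hB hs hc hd⟩
  | handleCE w _ H h hd => exact ⟨_, .handle w _ st⟩
  | handleLoop _ H h =>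
    by_cases hc : ∀ u ∈ st.pool, H.AgreesOn L u
    · exact ⟨_, .handle_done H _ st h.hyp hc⟩
    · push Not at hc
      obtain ⟨u, hu, hd⟩ := hc
      exact ⟨_, .handle_find H u _ st h.hyp hu hd⟩
  | find c z _ H h ha hd =>
    by_cases hl : ∃ a, z = SP.letter a
    · obtain ⟨a, rfl⟩ := hl
      exact ⟨_, .ebp_letter c a _ st⟩
    have hz : z ≠ SP.empty := by
      rintro rfl
      -- Agreement at the access sequence `ε` of `ε` contradicts the disagreement of `H` and `L` on
      -- `c[ε]`.
      exact hd (ha _ h.empty_mem_hypAccess)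
    obtain ⟨o, z₁, z₂, hdec⟩ :=
      CanonicalDecomposition.exists_of_ne hz fun a e => hl ⟨a, e⟩
    by_cases h₁ : st.Agree L H (c.comp (Context.holeLeft o z₂)) z₁
    · exact ⟨_, .ebp_left H c z o z₁ z₂ _ st h.hyp hdec h₁⟩
    obtain ⟨p₁, hp₁, hd₁⟩ : ∃ p₁ ∈ st.hypAccess H z₁, ¬ H.AgreesOn L (c.fill (SP.op o p₁ z₂)) := by
      by_contra! hc
      refine h₁ fun p hp => ?_
      rw [Context.fill_comp, Context.fill_holeLeft]
      exact hc p hp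
    by_cases h₂ : st.Agree L H (c.comp (Context.holeRight o p₁)) z₂
    · exact ⟨_, .ebp_right H c z o z₁ z₂ p₁ _ st h.hyp hdec h₁ hp₁ hd₁ h₂⟩
    obtain ⟨p₂, hp₂, hd₂⟩ : ∃ p₂ ∈ st.hypAccess H z₂, ¬ H.AgreesOn L (c.fill (SP.op o p₁ p₂)) := by
      by_contra! hc
      refine h₂ fun p hp => ?_
      rw [Context.fill_comp, Context.fill_holeRight]
      exact hc p hp
    exact ⟨_, .ebp_found H c z o z₁ z₂ p₁ p₂ _ st h.hyp hdec h₁ hp₁ hd₁ h₂ hp₂ hd₂⟩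
  | found c p _ H h _ _ _ => exact ⟨_, .handle_found H c p _ st h.hyp⟩

end Inv

/-! ## Termination -/

section Termination

variable {M : Type*} (L : Set (SP A)) (κ : SP A → M)

/-- The weight of a control point in the termination measure: what `Expand` and `FindEBP` have
still to do there. -/
noncomputable def Control.weight : Control A → ℕ
  | expand _ => 1
  -- One more than the weight of `expand`, into which this item may turn.
  | ensureAccess _ => 2
  | findEBP _ z => minDepth z
  | _ => 0

/-- The number of pending iterations of a control point. -/
def Control.todoSize : Control A → ℕ
  -- The additional unit pays for leaving the loop when it is empty.
  | expandLoop todo => todo.card + 1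
  | _ => 0

open Classical in
/-- The phases of the learner, numbered in such a way that the number decreases when the learner
proceeds to the next phase without making progress. -/
noncomputable def phase (st : Store A) : List (Control A) → ℕ
  | [] => 0
  | refine _ _ :: _ => 0
  -- A fresh `p` is about to increase `found`, so this phase may lie below that of `foundEBP`. For
  -- any other `p` the phase equals that of the loops of `Expand`, and the weight decreases instead.
  | expand p :: _ => if ∀ s ∈ st.S, κ s ≠ κ p then 0 else 13
  | foundEBP _ _ :: _ => 1
  | findEBP _ _ :: _ => 2
  -- With a counter-example in the pool the loop must lie below `handleCE`, from which it is
  -- entered; without one it must lie above `compatLoop`, to which it exits. Both values are below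
  -- that of `buildHypothesis`.
  | handleLoop :: _ => if ∃ H, st.hyp = some H ∧ ∃ u ∈ st.pool, ¬ H.AgreesOn L u then 3 else 7
  | handleCE _ :: _ => 4
  | mainLoop :: _ => 5
  | compatLoop :: _ => 6
  | buildHypothesis :: _ => 8
  -- A flag is lowered only together with a refinement, which counts as progress by itself. The
  -- repeated round then starts with its flag raised, so rounds with lowered flags can be placed
  -- above it.
  | makeAssoc true true :: _ => 9
  | makeConsistent true :: _ => 10
  | makeAssoc _ _ :: _ => 11
  | makeConsistent false :: _ => 12
  | expandLoop _ :: _ => 13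
  | ensureAccess _ :: _ => 13

/-- The number of contextual classes found so far: those of the access sequences, and those that
are separated by the tree. -/
noncomputable def found (st : Store A) : ℕ := (κ '' (st.S : Set (SP A))).ncard + st.tree.leafCount

/-- The termination measure. -/
noncomputable def rank : Config A → ℕ × ℕ × ℕ × ℕ
  | running k st => (2 * Nat.card M - found κ st, phase L κ st k,
      (k.map Control.weight).sum, (k.map Control.todoSize).sum)
  | returned _ => (0, 0, 0, 0)

/-- The measure decreases from `cfg` to `cfg'`. -/
def Decreases (cfg' cfg : Config A) : Prop :=
  Prod.Lex (· < ·) (Prod.Lex (· < ·) (Prod.Lex (· < ·) (· < ·))) (rank L κ cfg') (rank L κ cfg)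

theorem wellFounded_decreases : WellFounded (Decreases L κ) :=
  InvImage.wf _ (wellFounded_lt.prod_lex
    (wellFounded_lt.prod_lex (wellFounded_lt.prod_lex wellFounded_lt)))

variable {L κ} {k k' : List (Control A)} {st st' : Store A}

theorem phase_le (st : Store A) (k : List (Control A)) : phase L κ st k ≤ 13 := by
  unfold phase
  split <;> first | omega | (split_ifs <;> omega)

theorem found_mono (hS : st.S ⊆ st'.S) (hT : st.tree.leafCount ≤ st'.tree.leafCount)
    [Finite M] : found κ st ≤ found κ st' :=
  Nat.add_le_add (Set.ncard_le_ncard (Set.image_mono (Finset.coe_subset.2 hS))) hT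

theorem found_le [Finite M]
    (hκ : ∀ u v, κ u = κ v → ∀ c : Context A, c.fill u ∈ L ↔ c.fill v ∈ L)
    (h : st.tree.WF L) : found κ st ≤ 2 * Nat.card M := by
  have h1 := h.leafCount_le hκ
  have h2 := Set.ncard_le_card (κ '' (st.S : Set (SP A)))
  rw [found]
  omega

/-- Subtraction is truncated, so the bound on the new value is needed for a strict decrease. -/
theorem Decreases.of_found_lt (h : found κ st < found κ st')
    (h' : found κ st' ≤ 2 * Nat.card M) :
    Decreases L κ (running k' st') (running k st) :=
  Prod.lex_def.2 (Or.inl (by simp only [rank]; omega))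

theorem Decreases.of_found_le (h : found κ st ≤ found κ st')
    (hk : phase L κ st' k' < phase L κ st k ∨ phase L κ st' k' ≤ phase L κ st k ∧
      ((k'.map Control.weight).sum < (k.map Control.weight).sum ∨
        (k'.map Control.weight).sum ≤ (k.map Control.weight).sum ∧
          (k'.map Control.todoSize).sum < (k.map Control.todoSize).sum)) :
    Decreases L κ (running k' st') (running k st) := by
  simp only [Decreases, rank, Prod.lex_def]
  omega

theorem Decreases.of_phase_lt (hS : st'.S = st.S) (hT : st'.tree = st.tree)
    (hk : phase L κ st' k' < phase L κ st k) :
    Decreases L κ (running k' st') (running k st) :=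
  .of_found_le (by rw [found, found, hS, hT]) (Or.inl hk)

theorem card_lt_of_erase {todo todo' : Finset (SP A)} {p : SP A} (hp : p ∈ todo)
    (h : ∀ x, x ∈ todo' ↔ x ∈ todo ∧ x ≠ p) : todo'.card < todo.card := by
  refine Finset.card_lt_card (Finset.ssubset_iff_subset_ne.2 ⟨fun x hx => ((h x).1 hx).1, ?_⟩)
  rintro rfl
  exact ((h p).1 hp).2 rfl

/-- Every step decreases the measure. -/
theorem Inv.decreases [Fintype A] [Finite M]
    (hκ : ∀ u v, κ u = κ v → ∀ c : Context A, c.fill u ∈ L ↔ c.fill v ∈ L)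
    {cfg cfg' : Config A} (hI : Inv L cfg) (hs : Step L cfg cfg') : Decreases L κ cfg' cfg := by
  -- The tree after the step has to be well formed in order to bound the new value of `found`.
  have hI' := hI.step hs
  cases hs with
  | expand w k st =>
    have hS : st.S ⊆ (st.addAccess w).S := fun x hx => mem_addAccess.2 (Or.inr hx)
    by_cases hw : ∀ s ∈ st.S, κ s ≠ κ w
    · refine .of_found_lt (Nat.add_lt_add_right (Set.ncard_lt_ncard ?_) _) (found_le hκ hI'.wf)
      refine (Set.ssubset_iff_of_subset (Set.image_mono (Finset.coe_subset.2 hS))).2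
        ⟨κ w, ⟨w, mem_addAccess.2 (Or.inl rfl), rfl⟩, ?_⟩
      rintro ⟨s, hs, he⟩
      exact hw s hs he
    · refine .of_found_le (found_mono hS le_rfl) (Or.inr ⟨?_, Or.inl ?_⟩)
      · rw [phase, phase, if_neg hw]
      · simp [Control.weight]
  | expand_done k st =>
    -- Whatever item comes next, its phase is at most 13, the phase of the item that has just been
    -- removed.
    refine .of_found_le le_rfl (Or.inr ⟨phase_le _ _, Or.inr ⟨?_, ?_⟩⟩)
    · simp [Control.weight]
    · simp [Control.todoSize]
  | expand_known p todo todo' k st hp htodo _ =>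
    have := card_lt_of_erase hp htodo
    refine .of_found_le le_rfl (Or.inr ⟨le_rfl, Or.inr ⟨?_, ?_⟩⟩)
    · simp [Control.weight]
    · simpa [Control.todoSize] using this
  | expand_insert p todo todo' k st B hp htodo _ _ =>
    have := card_lt_of_erase hp htodo
    refine .of_found_le (found_mono subset_rfl (DTree.leafCount_le_insert L p _))
      (Or.inr ⟨le_rfl, Or.inr ⟨?_, ?_⟩⟩)
    · simp [Control.weight]
    · simpa [Control.todoSize] using this
  | expand_new p todo todo' k st _ _ _ hs =>
    -- The new call of `Expand` adds weight, but an unlabelled leaf has received a label.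
    exact .of_found_lt (Nat.add_lt_add_left (DTree.leafCount_lt_insert hs) _)
      (found_le hκ hI'.wf)
  | refine B c z₁ z₂ k st hB _ _ _ =>
    exact .of_found_lt (Nat.add_lt_add_left (DTree.leafCount_lt_refine hB) _)
      (found_le hκ hI'.wf)
  | ensure_skip B B' s k st _ _ _ _ =>
    refine .of_found_le le_rfl (Or.inr ⟨phase_le _ _, Or.inl ?_⟩)
    simp [Control.weight]
  | ensure_expand B B' p k st _ _ _ _ =>
    refine .of_found_le le_rfl (Or.inr ⟨phase_le _ _, Or.inl ?_⟩)
    simp [Control.weight]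
  | consistent_refine B u v c e already k st _ _ _ =>
    refine .of_phase_lt rfl rfl ?_
    cases already <;> simp [phase]
  | consistent_done already k st _ =>
    refine .of_phase_lt rfl rfl ?_
    cases already <;> simp [phase]
  | consistent_again k st _ =>
    refine .of_phase_lt rfl rfl ?_
    simp [phase]
  | assoc_left o s₁ s₂ s₃ sl sr c B b b' k st _ _ _ _ _ _ =>
    refine .of_phase_lt rfl rfl ?_
    cases b <;> cases b' <;> simp [phase]
  | assoc_right o s₁ s₂ s₃ sl sr c B b b' k st _ _ _ _ _ _ =>
    refine .of_phase_lt rfl rfl ?_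
    cases b <;> cases b' <;> simp [phase]
  | assoc_done k st _ =>
    refine .of_phase_lt rfl rfl ?_
    cases hI with
    | assoc _ _ _ _ _ => simp [phase]
  | assoc_again b b' k st _ hb =>
    refine .of_phase_lt rfl rfl ?_
    revert hb
    cases b <;> cases b' <;> simp [phase]
  | build H k st _ =>
    refine .of_phase_lt rfl rfl ?_
    cases hI with
    | startBuild _ _ => simp [phase]
    | build _ _ _ _ =>
      simp only [phase]
      split_ifs <;> omega
  | ebp_letter c a k st => exact .of_phase_lt rfl rfl (by simp [phase])
  | ebp_left H c z o z₁ z₂ k st _ hz _ =>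
    refine .of_found_le le_rfl (Or.inr ⟨le_rfl, Or.inl ?_⟩)
    simpa [Control.weight] using hz.minDepth_lt.1
  | ebp_right H c z o z₁ z₂ p₁ k st _ hz _ _ _ _ =>
    refine .of_found_le le_rfl (Or.inr ⟨le_rfl, Or.inl ?_⟩)
    simpa [Control.weight] using hz.minDepth_lt.2
  | ebp_found H c z o z₁ z₂ p₁ p₂ k st _ _ _ _ _ _ _ _ =>
    exact .of_phase_lt rfl rfl (by simp [phase])
  | handle w k st =>
    cases hI with
    | handleCE _ _ H h hd =>
      refine .of_phase_lt rfl rfl ?_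
      -- The pool is `{w}` and `w` is a counter-example, so the loop is entered in its lower phase.
      rw [phase, phase, if_pos ⟨H, h.hyp, w, Finset.mem_singleton_self w, hd⟩]
      omega
  | handle_find H u k st hH hu hd =>
    refine .of_phase_lt rfl rfl ?_
    rw [phase, phase, if_pos ⟨H, hH, u, hu, hd⟩]
    omega
  | handle_found H c p k st _ =>
    cases hI with
    | found _ _ _ H' h hp ha hd =>
      refine .of_phase_lt rfl rfl ?_
      rw [phase, phase]
      -- No access sequence shares the `κ`-value of `p`; hence the coming expansion has phase 0.
      exact (if_pos (h.fresh hκ hp ha hd)).trans_lt Nat.zero_lt_one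
  | handle_done H k st hH hall =>
    cases hI with
    | handleLoop _ H' h =>
      refine .of_phase_lt rfl rfl ?_
      rw [phase, phase, if_neg]
      · omega
      · rintro ⟨H₁, hH₁, u, hu, hd⟩
        obtain rfl : H₁ = H := Option.some_injective _ (hH₁.symm.trans hH)
        exact hd (hall u hu)
  | learn_counterexample H w k st _ _ => exact .of_phase_lt rfl rfl (by simp [phase])
  | compat_handle H B s c k st _ _ _ _ _ => exact .of_phase_lt rfl rfl (by simp [phase])
  | compat_done H k st _ _ =>
    cases hI with
    | compat _ H' h => exact .of_phase_lt rfl rfl (by simp [phase])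
  | learn_return H st _ _ =>
    simp only [Decreases, rank, phase, Prod.lex_def]
    omega

end Termination

/-- The invariant holds after the first step. -/
theorem Inv.of_initial [Fintype A] {L : Set (SP A)} {cfg : Config A}
    (h : Step L (Config.initial A) cfg) : Inv L cfg := by
  cases h with
  | expand w k st => exact Inv.start (WorkInv.initial L rfl rfl) (FirstPhase.initial L rfl rfl)

end PomsetLearning

/-! ### Termination and correctness of the learner -/

theorem mainTheorem1 {A : Type*} [Fintype A] (L : Set (PomsetLearning.SP A))
    (hL : PomsetLearning.IsRecognizable L) :
    (¬ ∃ run : ℕ → PomsetLearning.Config A,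
      run 0 = PomsetLearning.Config.initial A ∧
        ∀ n, PomsetLearning.Step L (run n) (run (n + 1))) ∧
    (∀ cfg : PomsetLearning.Config A,
      Relation.ReflTransGen (PomsetLearning.Step L) (PomsetLearning.Config.initial A) cfg →
        (¬ ∃ cfg', PomsetLearning.Step L cfg cfg') →
          ∃ H : PomsetLearning.Hypothesis A,
            cfg = PomsetLearning.Config.returned H ∧ H.language = L) := by
  open PomsetLearning in
  constructor
  · rintro ⟨run, h0, hrun⟩
    obtain ⟨M, _, κ, hκ⟩ := hL.exists_invariant
    -- The index is shifted because the initial configuration does not satisfy the invariant: `ε` is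
    -- not yet in `S`. It holds from the first step on.
    have hinv : ∀ n, Inv L (run (n + 1)) := by
      intro n
      induction n with
      | zero => exact Inv.of_initial (h0 ▸ hrun 0)
      | succ n ih => exact ih.step (hrun (n + 1))
    -- A configuration of minimal rank along the run would be followed by one of smaller rank.
    obtain ⟨_, ⟨n, rfl⟩, hmin⟩ := (wellFounded_decreases L κ).has_min
      (Set.range fun n => run (n + 1)) ⟨_, 0, rfl⟩
    exact hmin _ ⟨n + 1, rfl⟩ ((hinv n).decreases hκ (hrun (n + 1)))
  · intro cfg hreach hstuck
    have hcases : cfg = Config.initial A ∨ Inv L cfg := by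
      clear hstuck
      induction hreach with
      | refl => exact Or.inl rfl
      | tail _ hs ih =>
        rcases ih with rfl | ih
        · exact Or.inr (Inv.of_initial hs)
        · exact Or.inr (ih.step hs)
    rcases hcases with rfl | hI
    · exact absurd ⟨_, Step.expand _ _ _⟩ hstuck
    · cases cfg with
      | running k st => exact absurd hI.exists_step hstuck
      | returned H =>
        cases hI with
        | returned _ h => exact ⟨H, rfl, h⟩
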